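/- Let $n\in\{2,3\}$ and let $\Omega\subset\mathbb{R}^n$ be a bounded, simply connected domain with Lipschitz boundary $\Gamma=\partial\Omega$ (for instance a possibly curvilinear polygon or polyhedron), such that the geodesic distance on $\Gamma$ is bounded by a constant times the Euclidean distance. Integrals over $\Gamma$ are taken with respect to the surface measure. For $\tau\subseteq\Gamma$ put $$|v|_{1/2,\tau}^2=\int_\tau\int_\tau\frac{|v(t)-v(s)|^2}{|t-s|^n}\,ds\,dt,\qquad \|v\|_{1/2,\tau}^2=\|v\|_{L^2(\tau)}^2+|v|_{1/2,\tau}^2,$$ and let $H^{1/2}(\Gamma)=\{v\in L^2(\Gamma): |v|_{1/2,\Gamma}<\infty\}$ (real-valued functions). Let $\mathcal{T}_h$ be a conforming decomposition of $\Gamma$ into finitely many possibly curvilinear segments ($n=2$) or triangles ($n=3$), i.e. injective continuous images $T=F_T(S)$ of the standard simplex $S$ with $n$ vertices, any two distinct elements meeting in a common proper face (the empty set, a vertex or an edge). Let $h=\max_T \operatorname{diam}T$ be its mesh size, $\mathcal N$ its set of nodes and, for $y\in\mathcal N$, let $\omega_y$ be the union of the elements having $y$ as a vertex. The mesh is quasi-uniform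 with constant $\kappa$ if $h\le\kappa\operatorname{diam}T$ for all $T$, and shape regular with constant $\sigma$ if $\operatorname{diam}(T)\,|\hat x-\hat y|\le\sigma|F_T(\hat x)-F_T(\hat y)|$ and $|F_T(\hat x)-F_T(\hat y)|\le\sigma\operatorname{diam}(T)\,|\hat x-\hat y|$ for all $T$ and $\hat x,\hat y\in S$; here $|\hat x-\hat y|$ is the maximum norm on $S\subset\mathbb{R}^n$. Then for all constants $\sigma,\kappa,K\in\mathbb{R}$ and $M\ge 0$ there is a constant $C>0$, depending only on $\Omega,\sigma,\kappa,K,M$ (in particular not on $h$), such that the following holds for every mesh $\mathcal{T}_h$ that is shape regular with constant $\sigma$ and quasi-uniform with constant $\kappa$. Let $\Pi:H^{1/2}(\Gamma)\to H^{1/2}(\Gamma)$ be a linear (possibly oblique) projector, $\Pi^2=\Pi$, with $\|\Pi v\|_{1/2,\Gamma}\le M\|v\|_{1/2,\Gamma}$ for all $v$, and let $\phi^\star_y\in L^2(\Gamma)$, $y\in\mathcal N$, be (not necessarily linearly independent) functions with $$\int_\Gamma\phi^\star_y(s)\,ds=1,\qquad \operatorname{supp}\phi^\star_y\subseteq\omega_y,\qquad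 K^{-1}h^{1/2-n/2}\le\|\phi^\star_y\|_{L^2(\omega_y)}\le K h^{1/2-n/2}\qquad (y\in\mathcal N),$$ such that $\int_\Gamma (v-\Pi v)\,\phi^\star_y\,ds=0$ for all $v\in H^{1/2}(\Gamma)$ and $y\in\mathcal N$. Then for all $v\in H^{1/2}(\Gamma)$ $$C^{-1}\|v\|_{1/2,\Gamma}^2\le\|\Pi v\|_{1/2,\Gamma}^2+\sum_{y\in\mathcal N}|v-\Pi v|_{1/2,\omega_y}^2\le C\|v\|_{1/2,\Gamma}^2 .$$ -/

import Mathlib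

open MeasureTheory Set Metric Topology
open scoped ENNReal NNReal

noncomputable section

namespace TraceNorm

/-! ### The domain and its boundary -/

/-- `Ω` has a Lipschitz boundary: near each boundary point, in the direction of a suitable unit
vector `e`, the set `Ω` is the strict epigraph of a Lipschitz function of the component
`z - ⟪e, z⟫ e` of `z` orthogonal to `e`. -/
def HasLipschitzBoundary {n : ℕ} (Ω : Set (EuclideanSpace ℝ (Fin n))) : Prop :=
  ∀ x ∈ frontier Ω, ∃ e : EuclideanSpace ℝ (Fin n), ‖e‖ = 1 ∧
    ∃ (g : EuclideanSpace ℝ (Fin n) → ℝ) (L : ℝ≥0), LipschitzWith L g ∧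
      ∃ U ∈ 𝓝 x, ∀ z ∈ U, (z ∈ Ω ↔ g (z - inner ℝ e z • e) < inner ℝ e z)

/-- Geodesic distance on a subset `Γ` of a Euclidean space: the infimum of the lengths of the
continuous curves in `Γ` from `x` to `y` (infinite if there is no rectifiable one). -/
def geodesicEDist {n : ℕ} (Γ : Set (EuclideanSpace ℝ (Fin n)))
    (x y : EuclideanSpace ℝ (Fin n)) : ℝ≥0∞ :=
  ⨅ (γ : ℝ → EuclideanSpace ℝ (Fin n)) (_ : ContinuousOn γ (Icc 0 1))
    (_ : MapsTo γ (Icc 0 1) Γ) (_ : γ 0 = x) (_ : γ 1 = y), eVariationOn γ (Icc 0 1)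

/-- A bounded simply connected domain of `ℝⁿ`, `n = 2, 3`, with Lipschitz boundary, which is non
degenerate: on the boundary the geodesic distance is bounded by a constant times the Euclidean
distance. -/
structure Domain (n : ℕ) where
  carrier : Set (EuclideanSpace ℝ (Fin n))
  two_or_three : n = 2 ∨ n = 3
  isOpen : IsOpen carrier
  isBounded : Bornology.IsBounded carrier
  isSimplyConnected : IsSimplyConnected carrier
  hasLipschitzBoundary : HasLipschitzBoundary carrier
  nondegenerate : ∃ C : ℝ≥0, ∀ x ∈ frontier carrier, ∀ y ∈ frontier carrier,
    geodesicEDist (frontier carrier) x y ≤ C * edist x y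

namespace Domain

variable {n : ℕ} (Ω : Domain n)

/-- The boundary `Γ = ∂Ω`. -/
def Γ : Set (EuclideanSpace ℝ (Fin n)) := frontier Ω.carrier

/-- The surface measure on `Γ`: the `(n-1)`-dimensional Hausdorff measure, with the normalization
that gives Lebesgue measure on hyperplanes. -/
def surf : Measure (EuclideanSpace ℝ (Fin n)) := (μHE[n - 1]).restrict Ω.Γ

theorem isCompact_Γ : IsCompact Ω.Γ :=
  Metric.isCompact_of_isClosed_isBounded isClosed_frontier
    (Ω.isBounded.closure.subset frontier_subset_closure)

theorem exists_nhds_lt_top (x : EuclideanSpace ℝ (Fin n)) (hx : x ∈ Ω.Γ) :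
    ∃ U ∈ 𝓝 x, μHE[n - 1] (Ω.Γ ∩ U) < ∞ := by
  obtain ⟨e, he, g, L, hg, U, hU, hUΩ⟩ := Ω.hasLipschitzBoundary x hx
  have he0 : e ≠ 0 := by rintro rfl; simp at he
  have hee : inner ℝ e e = (1 : ℝ) := by rw [real_inner_self_eq_norm_sq, he]; norm_num
  obtain ⟨V, hVU, hVo, hxV⟩ := _root_.mem_nhds_iff.1 hU
  let H : Submodule ℝ (EuclideanSpace ℝ (Fin n)) := (ℝ ∙ e)ᗮ
  have hn : n - 1 + 1 = n := by rcases Ω.two_or_three with h | h <;> omega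
  have hdim : Module.finrank ℝ H = n - 1 := by
    have : Fact (Module.finrank ℝ (EuclideanSpace ℝ (Fin n)) = n - 1 + 1) := ⟨by simp [hn]⟩
    exact Submodule.finrank_orthogonal_span_singleton he0
  let G : H → EuclideanSpace ℝ (Fin n) := fun p => (p : EuclideanSpace ℝ (Fin n)) + g p • e
  have hG : LipschitzWith (1 + L) G := by
    refine LipschitzWith.of_dist_le_mul fun p q => ?_
    have h1 : dist (g p) (g q) ≤ L * dist p q := hg.dist_le_mul _ _
    calc dist (G p) (G q) ≤ dist (p : EuclideanSpace ℝ (Fin n)) q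
          + dist (g p • e) (g q • e) := dist_add_add_le _ _ _ _
      _ ≤ dist p q + L * dist p q := by
          refine add_le_add le_rfl ?_
          rw [dist_eq_norm, ← sub_smul, norm_smul, he, mul_one, ← dist_eq_norm]
          exact h1
      _ = (1 + L : ℝ≥0) * dist p q := by push_cast; ring
  refine ⟨V ∩ ball x 1, Filter.inter_mem (hVo.mem_nhds hxV) (ball_mem_nhds x one_pos), ?_⟩
  let R : ℝ := 2 * (‖x‖ + 1)
  have hsub : Ω.Γ ∩ (V ∩ ball x 1) ⊆ G '' closedBall (0 : H) R := by
    rintro z ⟨hzΓ, hzV, hzx⟩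
    have hle : inner ℝ e z ≤ g (z - inner ℝ e z • e) := by
      have hz : z ∉ Ω.carrier := by
        have := hzΓ
        rw [Γ, Ω.isOpen.frontier_eq] at this
        exact this.2
      by_contra h
      exact hz ((hUΩ z (hVU hzV)).2 (not_le.1 h))
    have hge : g (z - inner ℝ e z • e) ≤ inner ℝ e z := by
      have hgc : Continuous fun w : EuclideanSpace ℝ (Fin n) => g (w - inner ℝ e w • e) :=
        hg.continuous.comp (by fun_prop)
      have hcl : IsClosed {w : EuclideanSpace ℝ (Fin n) |
          g (w - inner ℝ e w • e) ≤ inner ℝ e w} :=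
        isClosed_le hgc (by fun_prop)
      have hz : z ∈ closure (V ∩ Ω.carrier) :=
        hVo.inter_closure ⟨hzV, frontier_subset_closure hzΓ⟩
      exact closure_minimal (fun w hw => ((hUΩ w (hVU hw.1)).1 hw.2).le) hcl hz
    have hp : z - inner ℝ e z • e ∈ H := by
      rw [Submodule.mem_orthogonal_singleton_iff_inner_right]
      rw [inner_sub_right, inner_smul_right, hee]; simp
    refine ⟨⟨_, hp⟩, ?_, ?_⟩
    · rw [mem_closedBall_zero_iff]
      have hzn : ‖z‖ ≤ ‖x‖ + 1 := by
        have : ‖z - x‖ < 1 := by rwa [mem_ball, dist_eq_norm] at hzx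
        have := norm_le_norm_add_norm_sub' z x
        linarith
      have hin : |inner ℝ e z| ≤ ‖z‖ := by
        have := abs_real_inner_le_norm e z
        rwa [he, one_mul] at this
      calc ‖z - inner ℝ e z • e‖ ≤ ‖z‖ + ‖inner ℝ e z • e‖ := norm_sub_le _ _
        _ ≤ R := by
          rw [norm_smul, he, mul_one, Real.norm_eq_abs]
          simp only [R]; linarith
    · simp only [G]
      rw [le_antisymm hge hle]; simp
  refine (measure_mono hsub).trans_lt ?_
  have hfin : μHE[n - 1] (closedBall (0 : H) R) < ∞ := by
    rw [← hdim]
    exact (isCompact_closedBall _ _).measure_lt_top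
  rw [Measure.euclideanHausdorffMeasure_def, Measure.smul_apply] at hfin ⊢
  have hc : (volume.addHaarScalarFactor
      (μH[((n - 1 : ℕ) : ℝ)] : Measure (EuclideanSpace ℝ (Fin (n - 1))))) ≠ 0 :=
    (Measure.addHaarScalarFactor_pos_of_isAddHaarMeasure _ _).ne'
  have h1 : μH[((n - 1 : ℕ) : ℝ)] (closedBall (0 : H) R) < ∞ := by
    by_contra h
    rw [not_lt, top_le_iff] at h
    rw [h, ENNReal.smul_def, smul_eq_mul, ENNReal.mul_top (by simpa using hc)] at hfin
    exact lt_irrefl _ hfin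
  have h2 := (hG.lipschitzOnWith (s := closedBall (0 : H) R)).hausdorffMeasure_image_le
    (d := ((n - 1 : ℕ) : ℝ)) (by positivity)
  rw [ENNReal.smul_def, smul_eq_mul]
  refine ENNReal.mul_lt_top ENNReal.coe_lt_top (h2.trans_lt (ENNReal.mul_lt_top ?_ h1))
  exact ENNReal.rpow_lt_top_of_nonneg (by positivity) ENNReal.coe_ne_top

instance isFiniteMeasure_surf : IsFiniteMeasure Ω.surf := by
  refine ⟨?_⟩
  rw [surf, Measure.restrict_apply_univ]
  obtain ⟨t, hs, ht⟩ := Ω.isCompact_Γ.induction_on (p := fun s => ∃ t, s ⊆ t ∧ μHE[n - 1] t < ∞)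
    ⟨∅, by simp⟩ (fun s t hst ⟨u, hu, h⟩ => ⟨u, hst.trans hu, h⟩)
    (fun s t ⟨u, hu, h⟩ ⟨w, hw, h'⟩ => ⟨u ∪ w, union_subset_union hu hw,
      measure_union_lt_top h h'⟩)
    (fun x hx => by
      obtain ⟨U, hU, h⟩ := Ω.exists_nhds_lt_top x hx
      exact ⟨Ω.Γ ∩ U, inter_mem_nhdsWithin _ hU, _, subset_rfl, h⟩)
  exact (measure_mono hs).trans_lt ht

end Domain

/-! ### The space `H^{1/2}(Γ)` -/

/-- The squared seminorm `|v|²_{1/2,τ} = ∫_τ ∫_τ |v(t) - v(s)|² / |t - s|ⁿ ds dt` with respect to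
the measure `μ`, as a possibly infinite quantity. -/
def seminormSq {n : ℕ} (μ : Measure (EuclideanSpace ℝ (Fin n))) (τ : Set (EuclideanSpace ℝ (Fin n)))
    (v : EuclideanSpace ℝ (Fin n) → ℝ) : ℝ≥0∞ :=
  ∫⁻ t in τ, ∫⁻ s in τ, ENNReal.ofReal (|v t - v s| ^ 2 / dist t s ^ n) ∂μ ∂μ

/-- The squared norm `‖v‖²_{1/2,τ} = ‖v‖²_{0,τ} + |v|²_{1/2,τ}`. -/
def normSq {n : ℕ} (μ : Measure (EuclideanSpace ℝ (Fin n))) (τ : Set (EuclideanSpace ℝ (Fin n)))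
    (v : EuclideanSpace ℝ (Fin n) → ℝ) : ℝ≥0∞ :=
  (∫⁻ s in τ, ENNReal.ofReal (|v s| ^ 2) ∂μ) + seminormSq μ τ v

section

variable {n : ℕ} {μ : Measure (EuclideanSpace ℝ (Fin n))} {τ : Set (EuclideanSpace ℝ (Fin n))}
  {v w : EuclideanSpace ℝ (Fin n) → ℝ}

theorem seminormSq_congr (h : v =ᵐ[μ] w) : seminormSq μ τ v = seminormSq μ τ w := by
  have h' := ae_restrict_of_ae (s := τ) h
  refine lintegral_congr_ae (h'.mono fun t ht => ?_)
  refine lintegral_congr_ae (h'.mono fun s hs => ?_)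
  simp only [ht, hs]

theorem measurable_kernel (hv : Measurable v) :
    Measurable fun p : EuclideanSpace ℝ (Fin n) × EuclideanSpace ℝ (Fin n) =>
      ENNReal.ofReal (|v p.1 - v p.2| ^ 2 / dist p.1 p.2 ^ n) := by
  refine ENNReal.measurable_ofReal.comp (Measurable.div ?_ ?_)
  · exact ((hv.comp measurable_fst).sub (hv.comp measurable_snd)).abs.pow_const 2
  · exact (measurable_fst.dist measurable_snd).pow_const n

theorem seminormSq_smul_lt_top (c : ℝ) (hv : seminormSq μ τ v < ∞) :
    seminormSq μ τ (c • v) < ∞ := by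
  have : seminormSq μ τ (c • v) = ENNReal.ofReal (c ^ 2) * seminormSq μ τ v := by
    unfold seminormSq
    rw [← lintegral_const_mul' _ _ ENNReal.ofReal_ne_top]
    congr 1; ext t
    rw [← lintegral_const_mul' _ _ ENNReal.ofReal_ne_top]
    congr 1; ext s
    rw [← ENNReal.ofReal_mul (sq_nonneg c)]
    congr 1
    simp only [Pi.smul_apply, smul_eq_mul, ← mul_sub, abs_mul, mul_pow, sq_abs]
    ring
  rw [this]
  exact ENNReal.mul_lt_top ENNReal.ofReal_lt_top hv

theorem seminormSq_add_lt_top [SFinite μ] (hvm : Measurable v)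
    (hv : seminormSq μ τ v < ∞) (hw : seminormSq μ τ w < ∞) :
    seminormSq μ τ (v + w) < ∞ := by
  have key : seminormSq μ τ (v + w) ≤ ENNReal.ofReal 2 * (seminormSq μ τ v + seminormSq μ τ w) := by
    unfold seminormSq
    have hk := measurable_kernel hvm
    rw [← lintegral_add_left hk.lintegral_prod_right', ← lintegral_const_mul' _ _ (by simp)]
    refine lintegral_mono fun t => ?_
    have hkt : Measurable fun s => ENNReal.ofReal (|v t - v s| ^ 2 / dist t s ^ n) :=
      ENNReal.measurable_ofReal.comp
        (((measurable_const.sub hvm).abs.pow_const 2).div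
          ((measurable_const.dist measurable_id).pow_const n))
    dsimp only
    rw [← lintegral_add_left hkt,
      ← lintegral_const_mul' _ _ (by simp)]
    refine lintegral_mono fun s => ?_
    rw [← ENNReal.ofReal_add (by positivity) (by positivity),
      ← ENNReal.ofReal_mul (by norm_num), ← add_div, ← mul_div_assoc]
    refine ENNReal.ofReal_le_ofReal (div_le_div_of_nonneg_right ?_ (by positivity))
    simp only [Pi.add_apply, sq_abs]
    nlinarith [sq_nonneg ((v t - v s) - (w t - w s))]
  exact key.trans_lt (ENNReal.mul_lt_top (by simp) (ENNReal.add_lt_top.2 ⟨hv, hw⟩))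

end

/-- `H^{1/2}(Γ)`, the subspace of the functions of `L²(Γ)` with finite `1/2`-seminorm. -/
def HHalf {n : ℕ} (Ω : Domain n) : Submodule ℝ (Lp ℝ 2 Ω.surf) where
  carrier := {v | seminormSq Ω.surf Ω.Γ v < ∞}
  zero_mem' := by
    simp only [mem_ofPred_eq]
    rw [seminormSq_congr (Lp.coeFn_zero ℝ 2 Ω.surf)]
    simp [seminormSq]
  add_mem' {v w} hv hw := by
    simp only [mem_ofPred_eq] at *
    rw [seminormSq_congr (Lp.coeFn_add v w)]
    exact seminormSq_add_lt_top (Lp.stronglyMeasurable v).measurable hv hw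
  smul_mem' c v hv := by
    simp only [mem_ofPred_eq] at *
    rw [seminormSq_congr (Lp.coeFn_smul c v)]
    exact seminormSq_smul_lt_top c hv

/-! ### Meshes -/

/-- The face of the standard simplex spanned by the vertices with index in `I`. -/
def simplexFace {n : ℕ} (I : Finset (Fin n)) : Set (Fin n → ℝ) :=
  {x ∈ stdSimplex ℝ (Fin n) | ∀ k, k ∉ I → x k = 0}

/-- A conforming decomposition of `Γ` into finitely many, possibly curvilinear, segments (`n = 2`)
or triangles (`n = 3`): injective continuous images of the standard simplex with `n` vertices.
Two distinct elements meet in a common proper face: the empty set, a vertex or an edge. -/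
structure Mesh {n : ℕ} (Γ : Set (EuclideanSpace ℝ (Fin n))) where
  card : ℕ
  chart : Fin card → (Fin n → ℝ) → EuclideanSpace ℝ (Fin n)
  continuousOn_chart : ∀ i, ContinuousOn (chart i) (stdSimplex ℝ (Fin n))
  injOn_chart : ∀ i, InjOn (chart i) (stdSimplex ℝ (Fin n))
  iUnion_eq : ⋃ i, chart i '' stdSimplex ℝ (Fin n) = Γ
  conforming : ∀ i j, i ≠ j → ∃ I J : Finset (Fin n), I ≠ Finset.univ ∧ J ≠ Finset.univ ∧
    chart i '' stdSimplex ℝ (Fin n) ∩ chart j '' stdSimplex ℝ (Fin n) =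
      chart i '' simplexFace I ∧
    chart i '' simplexFace I = chart j '' simplexFace J ∧
    (fun k => chart i (Pi.single k 1)) '' I = (fun k => chart j (Pi.single k 1)) '' J

namespace Mesh

variable {n : ℕ} {Γ : Set (EuclideanSpace ℝ (Fin n))} (𝒯 : Mesh Γ)

/-- The elements of the mesh. -/
def elem (i : Fin 𝒯.card) : Set (EuclideanSpace ℝ (Fin n)) :=
  𝒯.chart i '' stdSimplex ℝ (Fin n)

/-- The `k`-th vertex of the `i`-th element. -/
def vertex (i : Fin 𝒯.card) (k : Fin n) : EuclideanSpace ℝ (Fin n) :=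
  𝒯.chart i (Pi.single k 1)

open Classical in
/-- The set of nodes. -/
def nodes : Finset (EuclideanSpace ℝ (Fin n)) :=
  Finset.univ.image fun p : Fin 𝒯.card × Fin n => 𝒯.vertex p.1 p.2

/-- The patch of the elements sharing `y` as a vertex. -/
def patch (y : EuclideanSpace ℝ (Fin n)) : Set (EuclideanSpace ℝ (Fin n)) :=
  ⋃ (i : Fin 𝒯.card) (_ : ∃ k, 𝒯.vertex i k = y), 𝒯.elem i

/-- The mesh size: the largest diameter of an element. -/
def size : ℝ := ⨆ i, diam (𝒯.elem i)

/-- Quasi-uniformity: the diameters of all elements are comparable to the mesh size. -/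
def IsQuasiUniform (κ : ℝ) : Prop := ∀ i, 𝒯.size ≤ κ * diam (𝒯.elem i)

/-- Shape regularity: up to scaling by its diameter, each element is bi-Lipschitz equivalent to the
standard simplex, with a uniform constant. (For a flat element with affine chart this amounts to a
lower bound on its angles.) -/
def IsShapeRegular (σ : ℝ) : Prop :=
  ∀ i, ∀ x ∈ stdSimplex ℝ (Fin n), ∀ y ∈ stdSimplex ℝ (Fin n),
    diam (𝒯.elem i) * dist x y ≤ σ * dist (𝒯.chart i x) (𝒯.chart i y) ∧
    dist (𝒯.chart i x) (𝒯.chart i y) ≤ σ * diam (𝒯.elem i) * dist x y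

end Mesh

/-- The assumptions on a family of functions `φ_y ∈ L²(Γ)`, `y` a node of the mesh: unit integral,
support in the patch of `y`, and `L²`-norm on the patch comparable, with constant `K`, to
`h^{1/2 - n/2}`. -/
structure IsAdmissibleFamily {n : ℕ} {Ω : Domain n} (𝒯 : Mesh Ω.Γ) (K : ℝ)
    (φ : 𝒯.nodes → Lp ℝ 2 Ω.surf) : Prop where
  integral_eq_one : ∀ y : 𝒯.nodes, ∫ s, φ y s ∂Ω.surf = 1
  support_subset : ∀ y : 𝒯.nodes, ∀ᵐ s ∂Ω.surf, s ∉ 𝒯.patch y → φ y s = 0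
  le_norm : ∀ y : 𝒯.nodes, ENNReal.ofReal (K⁻¹ * 𝒯.size ^ ((1 : ℝ) / 2 - n / 2)) ≤
    eLpNorm (φ y) 2 (Ω.surf.restrict (𝒯.patch y))
  norm_le : ∀ y : 𝒯.nodes, eLpNorm (φ y) 2 (Ω.surf.restrict (𝒯.patch y)) ≤
    ENNReal.ofReal (K * 𝒯.size ^ ((1 : ℝ) / 2 - n / 2))

end TraceNorm

end

/-! Write w = v - Πv and h for the mesh size. The upper estimate is a matter of overlaps: elements
intersect in null sets and each one belongs only to the patches of its n vertices, so the patch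
seminorms of w sum to at most n times the global one (`sum_seminormSq_patch_le`); boundedness of Π
does the rest.

For the lower estimate, v = Πv + w, and the full norm of w must be bounded by its patch seminorms.
Two facts with opposite powers of h achieve this. Poincaré (`lintegral_patch_sq_le`): orthogonality
to φ_y, which has mean one and lives on ω_y, gives ‖w‖² ≤ C h |w|² on ω_y. Localization
(`seminormSq_le_sum_add`): pairs of points closer than δh share a patch, while the remaining pairs
contribute at most (C/h)‖w‖² on Γ, because the surface measure of a ball of radius r is at most A
r^(n-1) and so the kernel |t - s|⁻ⁿ has tail of order 1/r. In the product h cancels.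

The geometric core is that nearby points share a patch (`exists_common_patch`). Bounded geodesic
distance joins them by a short curve in Γ, and a connected set that is small compared with h meets
only elements that pairwise intersect (`inter_nonempty_of_isPreconnected`); by conformity,
intersecting elements share a vertex. -/

noncomputable section

namespace TraceNorm

/-! ### Geometry of shape regular conforming meshes -/

namespace Mesh

variable {n : ℕ} {Γ : Set (EuclideanSpace ℝ (Fin n))} (𝒯 : Mesh Γ)

theorem isCompact_elem (i : Fin 𝒯.card) : IsCompact (𝒯.elem i) :=
  (isCompact_stdSimplex ℝ (Fin n)).image_of_continuousOn (𝒯.continuousOn_chart i)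

theorem elem_subset (i : Fin 𝒯.card) : 𝒯.elem i ⊆ Γ :=
  (subset_iUnion (fun i => 𝒯.chart i '' stdSimplex ℝ (Fin n)) i).trans 𝒯.iUnion_eq.subset

theorem exists_mem_elem {x : EuclideanSpace ℝ (Fin n)} (hx : x ∈ Γ) : ∃ i, x ∈ 𝒯.elem i := by
  rw [← 𝒯.iUnion_eq] at hx
  exact mem_iUnion.1 hx

theorem isCompact_patch (y : EuclideanSpace ℝ (Fin n)) : IsCompact (𝒯.patch y) :=
  isCompact_iUnion fun i => isCompact_iUnion fun _ => 𝒯.isCompact_elem i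

theorem patch_subset (y : EuclideanSpace ℝ (Fin n)) : 𝒯.patch y ⊆ Γ :=
  iUnion₂_subset fun i _ => 𝒯.elem_subset i

theorem elem_subset_patch (i : Fin 𝒯.card) (k : Fin n) : 𝒯.elem i ⊆ 𝒯.patch (𝒯.vertex i k) :=
  subset_iUnion₂_of_subset i ⟨k, rfl⟩ subset_rfl

theorem vertex_mem_nodes (i : Fin 𝒯.card) (k : Fin n) : 𝒯.vertex i k ∈ 𝒯.nodes := by
  classical
  exact Finset.mem_image.2 ⟨(i, k), Finset.mem_univ _, rfl⟩

theorem vertex_mem_elem (i : Fin 𝒯.card) (k : Fin n) : 𝒯.vertex i k ∈ 𝒯.elem i :=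
  mem_image_of_mem _ (single_mem_stdSimplex ℝ k)

theorem diam_elem_le_size (i : Fin 𝒯.card) : diam (𝒯.elem i) ≤ 𝒯.size :=
  le_ciSup (f := fun i => diam (𝒯.elem i)) (Set.finite_range _).bddAbove i

/-- For n ≥ 2 the simplex has two vertices, and injectivity of the chart keeps their images apart.
-/
theorem diam_elem_pos (hn : 2 ≤ n) (i : Fin 𝒯.card) : 0 < diam (𝒯.elem i) := by
  have hne : (⟨0, by omega⟩ : Fin n) ≠ ⟨1, by omega⟩ := by simp
  refine (dist_pos.2 fun h => hne ?_).trans_le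
    (dist_le_diam_of_mem (𝒯.isCompact_elem i).isBounded (𝒯.vertex_mem_elem i ⟨0, by omega⟩)
      (𝒯.vertex_mem_elem i ⟨1, by omega⟩))
  have := 𝒯.injOn_chart i (single_mem_stdSimplex ℝ _) (single_mem_stdSimplex ℝ _) h
  by_contra hne'
  have h0 := congrFun this ⟨0, by omega⟩
  simp at h0

theorem size_pos (hn : 2 ≤ n) (i : Fin 𝒯.card) : 0 < 𝒯.size :=
  (𝒯.diam_elem_pos hn i).trans_le (𝒯.diam_elem_le_size i)

theorem size_le_diam (hΓ : Bornology.IsBounded Γ) : 𝒯.size ≤ diam Γ :=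
  Real.iSup_le (fun i => diam_mono (𝒯.elem_subset i) hΓ) diam_nonneg

theorem dist_le_of_mem_patch {y s t : EuclideanSpace ℝ (Fin n)} (hs : s ∈ 𝒯.patch y)
    (ht : t ∈ 𝒯.patch y) : dist t s ≤ 2 * 𝒯.size := by
  simp only [patch, mem_iUnion, exists_prop] at hs ht
  obtain ⟨i, ⟨k, hk⟩, hs⟩ := hs
  obtain ⟨j, ⟨l, hl⟩, ht⟩ := ht
  have h1 := dist_le_diam_of_mem (𝒯.isCompact_elem i).isBounded (𝒯.vertex_mem_elem i k) hs
  have h2 := dist_le_diam_of_mem (𝒯.isCompact_elem j).isBounded ht (𝒯.vertex_mem_elem j l)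
  have h3 := 𝒯.diam_elem_le_size i
  have h4 := 𝒯.diam_elem_le_size j
  rw [hl] at h2
  rw [hk] at h1
  linarith [dist_triangle t y s]

variable {𝒯}

theorem IsShapeRegular.mono {σ τ : ℝ} (h : 𝒯.IsShapeRegular σ) (hστ : σ ≤ τ) :
    𝒯.IsShapeRegular τ := fun i x hx y hy =>
  ⟨(h i x hx y hy).1.trans (by gcongr),
    (h i x hx y hy).2.trans (by have := diam_nonneg (s := 𝒯.elem i); gcongr)⟩

theorem IsQuasiUniform.mono {κ τ : ℝ} (h : 𝒯.IsQuasiUniform κ) (hκτ : κ ≤ τ) :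
    𝒯.IsQuasiUniform τ := fun i =>
  (h i).trans (by have := diam_nonneg (s := 𝒯.elem i); gcongr)

/-- Two intersecting elements have a common vertex. -/
theorem exists_vertex_eq_vertex (hn : 2 ≤ n) {i j : Fin 𝒯.card}
    (hij : (𝒯.elem i ∩ 𝒯.elem j).Nonempty) : ∃ k l, 𝒯.vertex i k = 𝒯.vertex j l := by
  rcases eq_or_ne i j with rfl | hne
  · exact ⟨⟨0, by omega⟩, ⟨0, by omega⟩, rfl⟩
  obtain ⟨I, J, -, -, h1, -, h3⟩ := 𝒯.conforming i j hne
  obtain ⟨x, hx⟩ := hij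
  have hx' : x ∈ 𝒯.chart i '' simplexFace I := h1 ▸ hx
  obtain ⟨a, ⟨ha, haI⟩, -⟩ := hx'
  -- Barycentric coordinates sum to 1, so a face containing a point has a vertex.
  obtain ⟨k, hk⟩ : I.Nonempty := by
    by_contra hI
    rw [Finset.not_nonempty_iff_eq_empty] at hI
    have := ha.2
    rw [Finset.sum_eq_zero fun k _ => haI k (by simp [hI])] at this
    exact zero_ne_one this
  have : 𝒯.vertex i k ∈ (fun k => 𝒯.chart j (Pi.single k 1)) '' J :=
    h3 ▸ mem_image_of_mem _ hk
  obtain ⟨l, -, hl⟩ := this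
  exact ⟨k, l, hl.symm⟩

/-- A vertex of an element lying in another one is a vertex of the latter. -/
theorem exists_vertex_eq_of_mem {i j : Fin 𝒯.card} {k : Fin n} (h : 𝒯.vertex i k ∈ 𝒯.elem j) :
    ∃ l, 𝒯.vertex j l = 𝒯.vertex i k := by
  rcases eq_or_ne i j with rfl | hne
  · exact ⟨k, rfl⟩
  obtain ⟨I, J, -, -, h1, -, h3⟩ := 𝒯.conforming i j hne
  have hx' : 𝒯.vertex i k ∈ 𝒯.chart i '' simplexFace I := h1 ▸ ⟨𝒯.vertex_mem_elem i k, h⟩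
  obtain ⟨a, ⟨ha, haI⟩, hak⟩ := hx'
  have hae := 𝒯.injOn_chart i ha (single_mem_stdSimplex ℝ k) hak
  have hk : k ∈ I := by
    by_contra hk
    have := haI k hk
    rw [hae] at this
    simp at this
  have : 𝒯.vertex i k ∈ (fun k => 𝒯.chart j (Pi.single k 1)) '' J :=
    h3 ▸ mem_image_of_mem _ hk
  obtain ⟨l, -, hl⟩ := this
  exact ⟨l, hl⟩

/-- The elements with `p` and those without form two closed sets covering Z; a connected Z meeting
both meets their intersection. -/
theorem exists_mem_inter_of_isPreconnected {Z : Set (EuclideanSpace ℝ (Fin n))}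
    (hZ : IsPreconnected Z) (hZΓ : Z ⊆ Γ) {p : Fin 𝒯.card → Prop} {i j : Fin 𝒯.card}
    (hi : (Z ∩ 𝒯.elem i).Nonempty) (hj : (Z ∩ 𝒯.elem j).Nonempty) (hpi : p i) (hpj : ¬ p j) :
    ∃ z ∈ Z, ∃ k l, p k ∧ ¬ p l ∧ z ∈ 𝒯.elem k ∧ z ∈ 𝒯.elem l := by
  have hcl : ∀ q : Fin 𝒯.card → Prop, IsClosed (⋃ (k) (_ : q k), 𝒯.elem k) := fun q =>
    isClosed_iUnion_of_finite fun k => isClosed_iUnion_of_finite fun _ =>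
      (𝒯.isCompact_elem k).isClosed
  obtain ⟨z, hzZ, hz1, hz2⟩ := isPreconnected_closed_iff.1 hZ _ _ (hcl p) (hcl fun k => ¬ p k)
    (fun z hz => by
      obtain ⟨k, hk⟩ := 𝒯.exists_mem_elem (hZΓ hz)
      by_cases hp : p k
      · exact Or.inl (mem_iUnion₂.2 ⟨k, hp, hk⟩)
      · exact Or.inr (mem_iUnion₂.2 ⟨k, hp, hk⟩))
    (hi.mono (inter_subset_inter_right _ (subset_iUnion₂_of_subset i hpi subset_rfl)))
    (hj.mono (inter_subset_inter_right _
      (subset_iUnion₂ (s := fun k (_ : ¬ p k) => 𝒯.elem k) j hpj)))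
  obtain ⟨k, hk, hzk⟩ := mem_iUnion₂.1 hz1
  obtain ⟨l, hl, hzl⟩ := mem_iUnion₂.1 hz2
  exact ⟨z, hzZ, k, l, hk, hl, hzk, hzl⟩

/-- A vertex of an element is far away from the opposite face. -/
theorem diam_le_mul_dist_vertex {σ : ℝ} (hσ : 𝒯.IsShapeRegular σ) {i : Fin 𝒯.card}
    {I : Finset (Fin n)} {k : Fin n} (hk : k ∉ I) {z : EuclideanSpace ℝ (Fin n)}
    (hz : z ∈ 𝒯.chart i '' simplexFace I) : diam (𝒯.elem i) ≤ σ * dist z (𝒯.vertex i k) := by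
  obtain ⟨a, ⟨ha, haI⟩, rfl⟩ := hz
  -- The k-th coordinates are 0 and 1.
  have h1 : 1 ≤ dist a (Pi.single k 1) := by
    have := dist_le_pi_dist a (Pi.single k 1) k
    simpa [haI k hk] using this
  have h2 := (hσ i a ha _ (single_mem_stdSimplex ℝ k)).1
  have := diam_nonneg (s := 𝒯.elem i)
  unfold vertex
  nlinarith

/-- On an edge, the coordinate of one endpoint is the max-norm distance to the other endpoint. If l
is the only vertex of the face, the point is that vertex itself. -/
theorem exists_dist_single_le {I : Finset (Fin n)} (hI : I.card ≤ 2) {a : Fin n → ℝ}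
    (ha : a ∈ simplexFace I) {l : Fin n} (hl : l ∈ I) :
    ∃ k, dist a (Pi.single k 1) ≤ a l := by
  obtain ⟨⟨ha0, hsum⟩, haI⟩ := ha
  have hs : ∑ k ∈ I, a k = 1 := by
    rw [← hsum]
    exact Finset.sum_subset (Finset.subset_univ _) fun k _ hk => haI k hk
  have hc : (I.erase l).card ≤ 1 := by rw [Finset.card_erase_of_mem hl]; omega
  rw [← Finset.add_sum_erase _ _ hl] at hs
  have : Nonempty (Fin n) := ⟨l⟩
  rcases Finset.card_le_one_iff_subset_singleton.1 hc with ⟨k, hk⟩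
  rcases Finset.subset_singleton_iff.1 hk with h | h
  · rw [h] at hs
    refine ⟨l, (dist_pi_le_iff (ha0 l)).2 fun m => ?_⟩
    rcases eq_or_ne m l with rfl | hm
    · simp at hs; simp [hs]
    · have : a m = 0 := haI m fun hmI => by
        have := Finset.mem_erase.2 ⟨hm, hmI⟩
        simp [h] at this
      simp [this, hm, ha0 l]
  · rw [h, Finset.sum_singleton] at hs
    have hkl : k ∈ I.erase l := by simp [h]
    refine ⟨k, (dist_pi_le_iff (ha0 l)).2 fun m => ?_⟩
    rcases eq_or_ne m k with rfl | hm
    · rw [Pi.single_eq_same, Real.dist_eq, abs_le]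
      constructor <;> linarith [ha0 l]
    · rw [Pi.single_eq_of_ne hm, Real.dist_0_eq_abs, abs_of_nonneg (ha0 m)]
      rcases eq_or_ne m l with rfl | hml
      · exact le_rfl
      · have : a m = 0 := haI m fun hmI => by
          have := Finset.mem_erase.2 ⟨hml, hmI⟩
          rw [h, Finset.mem_singleton] at this
          exact hm this
        rw [this]; exact ha0 l

/-- A point of a low dimensional face that is close to a face not containing it is close to a
vertex. -/
theorem exists_dist_vertex_le {σ : ℝ} (hσ0 : 0 ≤ σ) (hσ : 𝒯.IsShapeRegular σ) {i : Fin 𝒯.card}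
    {I J : Finset (Fin n)} (hI : I.card ≤ 2) {x z : EuclideanSpace ℝ (Fin n)}
    (hx : x ∈ 𝒯.chart i '' simplexFace I) (hxJ : x ∉ 𝒯.chart i '' simplexFace J)
    (hz : z ∈ 𝒯.chart i '' simplexFace J) :
    ∃ k, dist x (𝒯.vertex i k) ≤ σ ^ 2 * dist x z := by
  obtain ⟨a, ha, rfl⟩ := hx
  obtain ⟨b, hb, rfl⟩ := hz
  -- This coordinate vanishes on the face J but not at x, so it is at most the distance of the
  -- parameters; it also bounds the distance to a vertex.
  obtain ⟨l, hlJ, hl⟩ : ∃ l, l ∉ J ∧ a l ≠ 0 := by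
    by_contra! h
    exact hxJ ⟨a, ⟨ha.1, h⟩, rfl⟩
  have hlI : l ∈ I := by
    by_contra h
    exact hl (ha.2 l h)
  obtain ⟨k, hk⟩ := exists_dist_single_le hI ha hlI
  have hab : a l ≤ dist a b := by
    have := dist_le_pi_dist a b l
    rw [hb.2 l hlJ, Real.dist_0_eq_abs] at this
    exact (le_abs_self _).trans this
  refine ⟨k, ?_⟩
  have h1 := (hσ i a ha.1 b hb.1).1
  have h2 := (hσ i a ha.1 _ (single_mem_stdSimplex ℝ k)).2
  have h3 := diam_nonneg (s := 𝒯.elem i)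
  calc dist (𝒯.chart i a) (𝒯.vertex i k) ≤ σ * diam (𝒯.elem i) * dist a (Pi.single k 1) := h2
    _ ≤ σ * diam (𝒯.elem i) * dist a b := by
        have := hk.trans hab
        gcongr
    _ = σ * (diam (𝒯.elem i) * dist a b) := by ring
    _ ≤ σ * (σ * dist (𝒯.chart i a) (𝒯.chart i b)) := by gcongr
    _ = _ := by ring

theorem card_le_two (hn : n = 2 ∨ n = 3) {I : Finset (Fin n)} (hI : I ≠ Finset.univ) :
    I.card ≤ 2 := by
  have := (Finset.card_lt_iff_ne_univ I).2 hI
  rw [Fintype.card_fin] at this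
  omega

/-- Two elements hit by a small connected subset of `Γ` intersect each other. -/
theorem inter_nonempty_of_isPreconnected (hn : n = 2 ∨ n = 3) {σ κ : ℝ} (hσ1 : 1 ≤ σ) (hκ1 : 1 ≤ κ)
    (hσ : 𝒯.IsShapeRegular σ) (hκ : 𝒯.IsQuasiUniform κ) {Z : Set (EuclideanSpace ℝ (Fin n))}
    (hZ : IsPreconnected Z) (hZΓ : Z ⊆ Γ)
    (hd : ∀ x ∈ Z, ∀ z ∈ Z, dist x z ≤ 𝒯.size / (4 * σ ^ 3 * κ)) {i j : Fin 𝒯.card}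
    (hi : (Z ∩ 𝒯.elem i).Nonempty) (hj : (Z ∩ 𝒯.elem j).Nonempty) :
    (𝒯.elem i ∩ 𝒯.elem j).Nonempty := by
  have hn2 : 2 ≤ n := by omega
  have hh := 𝒯.size_pos hn2 i
  have hσ0 : 0 < σ := by linarith
  have hκ0 : 0 < κ := by linarith
  -- A lower bound, valid for all elements, for the distance of a vertex to its opposite face. The
  -- diameter of Z is at most c / (4σ²), which leaves room for the factor σ² lost in
  -- `exists_dist_vertex_le`.
  set c : ℝ := 𝒯.size / (σ * κ) with hc
  have hc0 : 0 < c := by positivity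
  have hd1 : ∀ x ∈ Z, ∀ z ∈ Z, σ ^ 2 * dist x z ≤ c / 4 := fun x hx z hz => by
    calc σ ^ 2 * dist x z ≤ σ ^ 2 * (𝒯.size / (4 * σ ^ 3 * κ)) := by
          have := hd x hx z hz
          gcongr
      _ = c / 4 := by rw [hc]; field_simp
  have hd2 : ∀ x ∈ Z, ∀ z ∈ Z, dist x z ≤ c / 4 := fun x hx z hz =>
    (le_mul_of_one_le_left dist_nonneg (one_le_pow₀ hσ1)).trans (hd1 x hx z hz)
  have hcd : ∀ k, c ≤ diam (𝒯.elem k) / σ := fun k => by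
    rw [hc, div_le_div_iff₀ (by positivity) hσ0]
    have := hκ k
    nlinarith
  -- Case 1: Z comes near a vertex. Then every element hit by Z contains that vertex, since
  -- otherwise Z would cross a face opposite to it, at distance at least c.
  by_cases hv : ∃ x ∈ Z, ∃ i₀ k, (Z ∩ 𝒯.elem i₀).Nonempty ∧ dist x (𝒯.vertex i₀ k) ≤ c / 2
  · obtain ⟨x, hx, i₀, k₀, hi₀, hxv⟩ := hv
    have key : ∀ m, (Z ∩ 𝒯.elem m).Nonempty → 𝒯.vertex i₀ k₀ ∈ 𝒯.elem m := by
      intro m hm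
      by_contra hmv
      obtain ⟨z, hz, k, l, hk, hl, hzk, hzl⟩ := exists_mem_inter_of_isPreconnected hZ hZΓ
        (p := fun m => 𝒯.vertex i₀ k₀ ∈ 𝒯.elem m) hi₀ hm (𝒯.vertex_mem_elem i₀ k₀) hmv
      have hkl : k ≠ l := by rintro rfl; exact hl hk
      obtain ⟨q, hq⟩ := exists_vertex_eq_of_mem hk
      obtain ⟨I, J, -, -, h1, -, -⟩ := 𝒯.conforming k l hkl
      have hzI : z ∈ 𝒯.chart k '' simplexFace I := h1 ▸ ⟨hzk, hzl⟩
      have hqI : q ∉ I := fun hqI => by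
        have h2 : 𝒯.vertex k q ∈ 𝒯.chart k '' simplexFace I :=
          ⟨_, ⟨single_mem_stdSimplex ℝ q, fun m hm => by
            rw [Pi.single_eq_of_ne]; rintro rfl; exact hm hqI⟩, rfl⟩
        rw [← h1, hq] at h2
        exact hl h2.2
      have h3 := diam_le_mul_dist_vertex hσ hqI hzI
      rw [hq] at h3
      have h4 : c ≤ dist z (𝒯.vertex i₀ k₀) :=
        (hcd k).trans (by rw [div_le_iff₀ hσ0]; linarith)
      have h5 := dist_triangle z x (𝒯.vertex i₀ k₀)
      have h6 := hd2 z hz x hx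
      linarith
    exact ⟨_, key i hi, key j hj⟩
  push Not at hv
  -- Case 2: Z avoids vertices but has a point x in two elements. Then every element hit by Z
  -- contains x, since otherwise Z would also meet a face of an element containing x that misses x;
  -- as x lies on an edge, it would be near a vertex.
  by_cases hx : ∃ x ∈ Z, ∃ i₀ j₀, i₀ ≠ j₀ ∧ x ∈ 𝒯.elem i₀ ∧ x ∈ 𝒯.elem j₀
  · obtain ⟨x, hx, i₀, j₀, hij₀, hxi, hxj⟩ := hx
    have key : ∀ m, (Z ∩ 𝒯.elem m).Nonempty → x ∈ 𝒯.elem m := by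
      intro m hm
      by_contra hmv
      obtain ⟨z, hz, k, l, hk, hl, hzk, hzl⟩ := exists_mem_inter_of_isPreconnected hZ hZΓ
        (p := fun m => x ∈ 𝒯.elem m) ⟨x, hx, hxi⟩ hm hxi hmv
      have hkl : k ≠ l := by rintro rfl; exact hl hk
      obtain ⟨r, hkr, hxr⟩ : ∃ r, k ≠ r ∧ x ∈ 𝒯.elem r := by
        by_cases h : k = i₀
        · exact ⟨j₀, h ▸ hij₀, hxj⟩
        · exact ⟨i₀, h, hxi⟩
      obtain ⟨I, -, hI, -, h1, -, -⟩ := 𝒯.conforming k r hkr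
      obtain ⟨J, -, -, -, h2, -, -⟩ := 𝒯.conforming k l hkl
      obtain ⟨q, hq⟩ := exists_dist_vertex_le hσ0.le hσ (card_le_two hn hI)
        (h1 ▸ ⟨hk, hxr⟩ : x ∈ 𝒯.chart k '' simplexFace I)
        (fun h => hl (h2.symm.subset h).2) (h2 ▸ ⟨hzk, hzl⟩ : z ∈ 𝒯.chart k '' simplexFace J)
      have h3 := hv x hx k q ⟨x, hx, hk⟩
      have h4 := hd1 x hx z hz
      linarith
    exact ⟨_, key i hi, key j hj⟩
  -- Case 3: no point of Z lies in two elements, so by connectedness Z stays in one.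
  · push Not at hx
    rcases eq_or_ne i j with rfl | hij
    · rw [inter_self]; exact hi.mono inter_subset_right
    · obtain ⟨z, hz, k, l, rfl, hl, hzk, hzl⟩ := exists_mem_inter_of_isPreconnected hZ hZΓ
        (p := fun m => m = i) hi hj rfl hij.symm
      exact absurd hzl (hx z hz k l (Ne.symm hl) hzk)

end Mesh

/-! ### Nearby points share a patch -/

/-- Points of `Γ` with finite geodesic distance are joined by a connected subset of `Γ` whose
diameter is controlled. -/
theorem exists_isPreconnected_of_geodesicEDist_lt {n : ℕ} {Γ : Set (EuclideanSpace ℝ (Fin n))}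
    {x y : EuclideanSpace ℝ (Fin n)} {r : ℝ≥0∞} (h : geodesicEDist Γ x y < r) :
    ∃ Z ⊆ Γ, IsPreconnected Z ∧ x ∈ Z ∧ y ∈ Z ∧ ∀ a ∈ Z, ∀ b ∈ Z, edist a b ≤ r := by
  simp only [geodesicEDist, iInf_lt_iff] at h
  obtain ⟨γ, hc, hm, h0, h1, hr⟩ := h
  refine ⟨γ '' Icc 0 1, hm.image_subset, isPreconnected_Icc.image _ hc,
    ⟨0, by simp, h0⟩, ⟨1, by simp, h1⟩, ?_⟩
  rintro _ ⟨s, hs, rfl⟩ _ ⟨t, ht, rfl⟩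
  exact (eVariationOn.edist_le γ hs ht).trans hr.le

/-- Points of `Γ` whose distance is small compared to the mesh size lie in a common patch. -/
theorem exists_common_patch {n : ℕ} (Ω : Domain n) {σ κ : ℝ} (hσ1 : 1 ≤ σ) (hκ1 : 1 ≤ κ) :
    ∃ δ : ℝ, 0 < δ ∧ ∀ 𝒯 : Mesh Ω.Γ, 𝒯.IsShapeRegular σ → 𝒯.IsQuasiUniform κ →
      ∀ s ∈ Ω.Γ, ∀ t ∈ Ω.Γ, dist t s < δ * 𝒯.size →
        ∃ y ∈ 𝒯.nodes, s ∈ 𝒯.patch y ∧ t ∈ 𝒯.patch y := by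
  obtain ⟨C, hC⟩ := Ω.nondegenerate
  have hn2 : 2 ≤ n := by have := Ω.two_or_three; omega
  -- Chosen so that a curve of length (C + 1)|t - s| has the small diameter needed for the mesh
  -- argument.
  refine ⟨1 / (4 * σ ^ 3 * κ * (C + 1)), by positivity, fun 𝒯 hσ hκ s hs t ht hst => ?_⟩
  obtain ⟨i, hi⟩ := 𝒯.exists_mem_elem hs
  obtain ⟨j, hj⟩ := 𝒯.exists_mem_elem ht
  have key : (𝒯.elem i ∩ 𝒯.elem j).Nonempty := by
    rcases eq_or_ne s t with rfl | hne
    · exact ⟨s, hi, hj⟩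
    -- Strictness is needed to extract a curve from the infimum; hence C + 1 and the separate case s
    -- = t.
    have hlt : geodesicEDist Ω.Γ s t < ((C + 1 : ℝ≥0) : ℝ≥0∞) * edist s t := by
      refine (hC s hs t ht).trans_lt ?_
      have h0 : edist s t ≠ 0 := by simpa using hne
      exact (ENNReal.mul_lt_mul_iff_left h0 (edist_ne_top _ _)).2 (by
        rw [ENNReal.coe_lt_coe]; exact lt_add_one C)
    obtain ⟨Z, hZΓ, hZ, hsZ, htZ, hd⟩ := exists_isPreconnected_of_geodesicEDist_lt hlt
    refine Mesh.inter_nonempty_of_isPreconnected Ω.two_or_three hσ1 hκ1 hσ hκ hZ hZΓ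
      (fun a ha b hb => ?_) ⟨s, hsZ, hi⟩ ⟨t, htZ, hj⟩
    have h1 := ENNReal.toReal_mono
      (ENNReal.mul_ne_top ENNReal.coe_ne_top (edist_ne_top _ _)) (hd a ha b hb)
    rw [ENNReal.toReal_mul, edist_dist, edist_dist, ENNReal.toReal_ofReal dist_nonneg,
      ENNReal.toReal_ofReal dist_nonneg, ENNReal.coe_toReal] at h1
    push_cast at h1
    calc dist a b ≤ (C + 1) * dist s t := h1
      _ ≤ (C + 1) * (1 / (4 * σ ^ 3 * κ * (C + 1)) * 𝒯.size) := by
          rw [dist_comm s t]; gcongr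
      _ = _ := by field_simp
  obtain ⟨k, l, hkl⟩ := Mesh.exists_vertex_eq_vertex hn2 key
  exact ⟨𝒯.vertex i k, 𝒯.vertex_mem_nodes i k, 𝒯.elem_subset_patch i k hi,
    hkl ▸ 𝒯.elem_subset_patch j l hj⟩

/-! ### Growth of the surface measure and the tail of the kernel -/

theorem euclideanHausdorffMeasure_image_le {X Y : Type*} [MetricSpace X] [MeasurableSpace X]
    [BorelSpace X] [MetricSpace Y] [MeasurableSpace Y] [BorelSpace Y] {f : X → Y} {L : ℝ≥0}
    (hf : LipschitzWith L f) (d : ℕ) (s : Set X) :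
    μHE[d] (f '' s) ≤ (L : ℝ≥0∞) ^ d * μHE[d] s := by
  have h := (hf.lipschitzOnWith (s := s)).hausdorffMeasure_image_le (d := (d : ℝ)) (by positivity)
  rw [ENNReal.rpow_natCast] at h
  simp only [Measure.euclideanHausdorffMeasure_def, Measure.smul_apply, ENNReal.smul_def,
    smul_eq_mul]
  calc _ ≤ _ := mul_le_mul_right h _
    _ = _ := by ring

namespace Domain

variable {n : ℕ} (Ω : Domain n)

/-- Near each of its points, `Γ` is contained in the graph of a Lipschitz function. -/
theorem exists_graph_of_mem (x : EuclideanSpace ℝ (Fin n)) (hx : x ∈ Ω.Γ) :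
    ∃ e : EuclideanSpace ℝ (Fin n), ‖e‖ = 1 ∧ ∃ (g : EuclideanSpace ℝ (Fin n) → ℝ) (L : ℝ≥0),
      LipschitzWith L g ∧ ∃ V, IsOpen V ∧ x ∈ V ∧
        ∀ z ∈ Ω.Γ ∩ V, g (z - inner ℝ e z • e) = inner ℝ e z := by
  obtain ⟨e, he, g, L, hg, U, hU, hUΩ⟩ := Ω.hasLipschitzBoundary x hx
  obtain ⟨V, hVU, hVo, hxV⟩ := _root_.mem_nhds_iff.1 hU
  refine ⟨e, he, g, L, hg, V, hVo, hxV, fun z ⟨hzΓ, hzV⟩ => le_antisymm ?_ ?_⟩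
  · have hgc : Continuous fun w : EuclideanSpace ℝ (Fin n) => g (w - inner ℝ e w • e) :=
      hg.continuous.comp (by fun_prop)
    have hcl : IsClosed {w : EuclideanSpace ℝ (Fin n) |
        g (w - inner ℝ e w • e) ≤ inner ℝ e w} :=
      isClosed_le hgc (by fun_prop)
    have hz : z ∈ closure (V ∩ Ω.carrier) :=
      hVo.inter_closure ⟨hzV, frontier_subset_closure hzΓ⟩
    exact closure_minimal (fun w hw => ((hUΩ w (hVU hw.1)).1 hw.2).le) hcl hz
  · have hz : z ∉ Ω.carrier := by
      have := hzΓ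
      rw [Γ, Ω.isOpen.frontier_eq] at this
      exact this.2
    by_contra h
    exact hz ((hUΩ z (hVU hzV)).2 (not_le.1 h))

/-- Near x, Γ lies in a Lipschitz graph over a hyperplane. A ball of radius r projects into a ball
of radius 2r there, and the graph map increases (n-1)-dimensional measure by at most (1 + L)^(n-1).
-/
theorem exists_measure_ball_le_of_mem (x : EuclideanSpace ℝ (Fin n)) (hx : x ∈ Ω.Γ) :
    ∃ A ρ : ℝ, 0 ≤ A ∧ 0 < ρ ∧ ∀ t ∈ ball x ρ, ∀ r, 0 < r → r < ρ →
      Ω.surf (ball t r) ≤ ENNReal.ofReal (A * r ^ (n - 1)) := by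
  obtain ⟨e, he, g, L, hg, V, hVo, hxV, hV⟩ := Ω.exists_graph_of_mem x hx
  have he0 : e ≠ 0 := by rintro rfl; simp at he
  have hee : inner ℝ e e = (1 : ℝ) := by rw [real_inner_self_eq_norm_sq, he]; norm_num
  obtain ⟨ρ, hρ, hρV⟩ := Metric.isOpen_iff.1 hVo x hxV
  let H : Submodule ℝ (EuclideanSpace ℝ (Fin n)) := (ℝ ∙ e)ᗮ
  have hn : n - 1 + 1 = n := by rcases Ω.two_or_three with h | h <;> omega
  have hdim : Module.finrank ℝ H = n - 1 := by
    have : Fact (Module.finrank ℝ (EuclideanSpace ℝ (Fin n)) = n - 1 + 1) := ⟨by simp [hn]⟩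
    exact Submodule.finrank_orthogonal_span_singleton he0
  let G : H → EuclideanSpace ℝ (Fin n) := fun p => (p : EuclideanSpace ℝ (Fin n)) + g p • e
  have hG : LipschitzWith (1 + L) G := by
    refine LipschitzWith.of_dist_le_mul fun p q => ?_
    have h1 : dist (g p) (g q) ≤ L * dist p q := hg.dist_le_mul _ _
    calc dist (G p) (G q) ≤ dist (p : EuclideanSpace ℝ (Fin n)) q
          + dist (g p • e) (g q • e) := dist_add_add_le _ _ _ _
      _ ≤ dist p q + L * dist p q := by
          refine add_le_add le_rfl ?_
          rw [dist_eq_norm, ← sub_smul, norm_smul, he, mul_one, ← dist_eq_norm]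
          exact h1
      _ = (1 + L : ℝ≥0) * dist p q := by push_cast; ring
  have hH : ∀ z : EuclideanSpace ℝ (Fin n), z - inner ℝ e z • e ∈ H := fun z => by
    rw [Submodule.mem_orthogonal_singleton_iff_inner_right]
    rw [inner_sub_right, inner_smul_right, hee]; simp
  have hB : μHE[n - 1] (ball (0 : H) 1) ≠ ∞ := by
    rw [← hdim]
    exact measure_ball_lt_top.ne
  refine ⟨(1 + L) ^ (n - 1) * (2 ^ (n - 1) * (μHE[n - 1] (ball (0 : H) 1)).toReal), ρ / 2,
    by positivity, half_pos hρ, fun t ht r hr hrρ => ?_⟩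
  have hsub : ball t r ∩ Ω.Γ ⊆ G '' closedBall (⟨_, hH t⟩ : H) (2 * r) := by
    rintro z ⟨hzt, hzΓ⟩
    have hzV : z ∈ V := hρV (by
      rw [mem_ball] at *
      linarith [dist_triangle z t x])
    refine ⟨⟨_, hH z⟩, ?_, ?_⟩
    · rw [mem_closedBall, Subtype.dist_eq, dist_eq_norm]
      have h1 : ‖z - t‖ < r := by rwa [mem_ball, dist_eq_norm] at hzt
      have h2 : |inner ℝ e (z - t)| ≤ ‖z - t‖ := by
        have := abs_real_inner_le_norm e (z - t)
        rwa [he, one_mul] at this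
      calc ‖z - inner ℝ e z • e - (t - inner ℝ e t • e)‖
          = ‖(z - t) - inner ℝ e (z - t) • e‖ := by rw [inner_sub_right, sub_smul]; congr 1; abel
        _ ≤ ‖z - t‖ + ‖inner ℝ e (z - t) • e‖ := norm_sub_le _ _
        _ ≤ 2 * r := by rw [norm_smul, he, mul_one, Real.norm_eq_abs]; linarith
    · simp only [G]
      rw [hV z ⟨hzΓ, hzV⟩]; simp
  rw [surf, Measure.restrict_apply measurableSet_ball]
  refine (measure_mono hsub).trans ((euclideanHausdorffMeasure_image_le hG _ _).trans_eq ?_)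
  have hball : μHE[n - 1] (closedBall (⟨_, hH t⟩ : H) (2 * r)) =
      ENNReal.ofReal ((2 * r) ^ (n - 1)) * μHE[n - 1] (ball (0 : H) 1) := by
    rw [← hdim]
    exact Measure.addHaar_closedBall _ _ (by positivity)
  rw [hball, ← ENNReal.ofReal_toReal hB, ENNReal.toReal_ofReal ENNReal.toReal_nonneg,
    ← ENNReal.ofReal_coe_nnreal, ← ENNReal.ofReal_pow (by positivity),
    ← ENNReal.ofReal_mul (by positivity), ← ENNReal.ofReal_mul (by positivity)]
  congr 1
  push_cast
  ring

/-- Upper Ahlfors regularity of the surface measure. -/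
theorem exists_measure_ball_le :
    ∃ A : ℝ, 0 ≤ A ∧ ∀ t ∈ Ω.Γ, ∀ r, 0 < r →
      Ω.surf (ball t r) ≤ ENNReal.ofReal (A * r ^ (n - 1)) := by
  obtain ⟨A, ρ, hA, hρ, h⟩ := Ω.isCompact_Γ.induction_on
    (p := fun s => ∃ A ρ : ℝ, 0 ≤ A ∧ 0 < ρ ∧ ∀ t ∈ s, ∀ r, 0 < r → r < ρ →
      Ω.surf (ball t r) ≤ ENNReal.ofReal (A * r ^ (n - 1)))
    ⟨0, 1, le_rfl, one_pos, by simp⟩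
    (fun s t hst ⟨A, ρ, hA, hρ, h⟩ => ⟨A, ρ, hA, hρ, fun z hz => h z (hst hz)⟩)
    (fun s t ⟨A, ρ, hA, hρ, h⟩ ⟨A', ρ', hA', hρ', h'⟩ =>
      ⟨max A A', min ρ ρ', hA.trans (le_max_left _ _), lt_min hρ hρ', fun z hz r hr hrρ => by
        rcases hz with hz | hz
        · exact (h z hz r hr (hrρ.trans_le (min_le_left _ _))).trans
            (ENNReal.ofReal_le_ofReal (by gcongr; exact le_max_left _ _))
        · exact (h' z hz r hr (hrρ.trans_le (min_le_right _ _))).trans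
            (ENNReal.ofReal_le_ofReal (by gcongr; exact le_max_right _ _))⟩)
    (fun x hx => by
      obtain ⟨A, ρ, hA, hρ, h⟩ := Ω.exists_measure_ball_le_of_mem x hx
      exact ⟨ball x ρ, mem_nhdsWithin_of_mem_nhds (ball_mem_nhds x hρ), A, ρ, hA, hρ, h⟩)
  -- The second entry handles radii r ≥ ρ through the finite total mass.
  refine ⟨max A ((Ω.surf univ).toReal / ρ ^ (n - 1)), hA.trans (le_max_left _ _),
    fun t ht r hr => ?_⟩
  rcases lt_or_ge r ρ with hrρ | hrρ
  · exact (h t ht r hr hrρ).trans (ENNReal.ofReal_le_ofReal (by gcongr; exact le_max_left _ _))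
  · refine (measure_mono (subset_univ _)).trans ?_
    refine (ENNReal.ofReal_toReal (measure_ne_top Ω.surf univ)).ge.trans
      (ENNReal.ofReal_le_ofReal ?_)
    calc (Ω.surf univ).toReal = (Ω.surf univ).toReal / ρ ^ (n - 1) * ρ ^ (n - 1) := by field_simp
      _ ≤ max A ((Ω.surf univ).toReal / ρ ^ (n - 1)) * r ^ (n - 1) := by
          gcongr
          exact le_max_right _ _

end Domain

/-- The tail of the kernel `|t - s|⁻ⁿ` for an `(n-1)`-dimensional measure. -/
theorem lintegral_inv_dist_pow_le {X : Type*} [PseudoMetricSpace X] [MeasurableSpace X]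
    [OpensMeasurableSpace X] {μ : Measure X} {m : ℕ} {A : ℝ} (hA : 0 ≤ A) {t : X}
    (h : ∀ r, 0 < r → μ (ball t r) ≤ ENNReal.ofReal (A * r ^ m)) {r : ℝ} (hr : 0 < r) :
    ∫⁻ s in {s | r ≤ dist t s}, ENNReal.ofReal ((dist t s ^ (m + 1))⁻¹) ∂μ ≤
      ENNReal.ofReal (A * 2 ^ (m + 1) / r) := by
  -- Dyadic decomposition: s lies in some annulus 2^k r ≤ |t - s| < 2^(k+1) r.
  have hpt : ∀ s ∈ {s | r ≤ dist t s}, ENNReal.ofReal ((dist t s ^ (m + 1))⁻¹) ≤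
      ∑' k : ℕ, (ball t (2 ^ (k + 1) * r)).indicator
        (fun _ => ENNReal.ofReal (((2 ^ k * r) ^ (m + 1))⁻¹)) s := by
    intro s hs
    obtain ⟨k, hk1, hk2⟩ := exists_nat_pow_near ((one_le_div hr).2 hs) (one_lt_two (α := ℝ))
    rw [le_div_iff₀ hr] at hk1
    rw [div_lt_iff₀ hr] at hk2
    refine le_trans ?_ (ENNReal.le_tsum k)
    rw [indicator_of_mem (by rwa [mem_ball, dist_comm])]
    exact ENNReal.ofReal_le_ofReal (by gcongr)
  have hms : MeasurableSet {s | r ≤ dist t s} :=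
    (isClosed_le continuous_const (continuous_const.dist continuous_id)).measurableSet
  calc ∫⁻ s in {s | r ≤ dist t s}, ENNReal.ofReal ((dist t s ^ (m + 1))⁻¹) ∂μ
      ≤ ∫⁻ s in {s | r ≤ dist t s}, ∑' k : ℕ, (ball t (2 ^ (k + 1) * r)).indicator
        (fun _ => ENNReal.ofReal (((2 ^ k * r) ^ (m + 1))⁻¹)) s ∂μ := setLIntegral_mono' hms hpt
    _ ≤ ∫⁻ s, ∑' k : ℕ, (ball t (2 ^ (k + 1) * r)).indicator
        (fun _ => ENNReal.ofReal (((2 ^ k * r) ^ (m + 1))⁻¹)) s ∂μ := setLIntegral_le_lintegral _ _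
    _ = ∑' k : ℕ, ENNReal.ofReal (((2 ^ k * r) ^ (m + 1))⁻¹) * μ (ball t (2 ^ (k + 1) * r)) := by
        rw [lintegral_tsum fun k => (measurable_const.indicator measurableSet_ball).aemeasurable]
        simp_rw [lintegral_indicator_const measurableSet_ball]
    -- The kernel decays one power faster than the mass grows, which leaves a geometric series.
    _ ≤ ∑' k : ℕ, ENNReal.ofReal (A * 2 ^ m / r * (1 / 2) ^ k) := by
        refine ENNReal.tsum_le_tsum fun k => ?_
        refine (mul_le_mul_right (h _ (by positivity)) _).trans_eq ?_
        rw [← ENNReal.ofReal_mul (by positivity)]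
        congr 1
        rw [one_div, inv_pow]
        field_simp
        ring
    _ = ENNReal.ofReal (A * 2 ^ (m + 1) / r) := by
        rw [← ENNReal.ofReal_tsum_of_nonneg (fun k => by positivity)
          (summable_geometric_two.mul_left _), tsum_mul_left, tsum_geometric_two]
        congr 1
        ring

theorem setLIntegral_le_sum {X ι : Type*} [MeasurableSpace X] {μ : Measure X} (S : Finset ι)
    {s : ι → Set X} {τ : Set X} (h : ∀ x ∈ τ, ∃ i ∈ S, x ∈ s i) (f : X → ℝ≥0∞) :
    ∫⁻ x in τ, f x ∂μ ≤ ∑ i ∈ S, ∫⁻ x in s i, f x ∂μ := by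
  classical
  refine (lintegral_mono_set (t := ⋃ i ∈ S, s i) fun x hx => ?_).trans ?_
  · obtain ⟨i, hi, hxi⟩ := h x hx
    exact mem_iUnion₂.2 ⟨i, hi, hxi⟩
  clear h
  induction S using Finset.induction_on with
  | empty => simp
  | insert a S ha ih =>
    rw [Finset.set_biUnion_insert, Finset.sum_insert ha]
    exact (lintegral_union_le _ _ _).trans (add_le_add le_rfl ih)

theorem ofReal_le_two_mul_add {a b c : ℝ} (hb : 0 ≤ b) (hc : 0 ≤ c) (h : a ≤ 2 * (b + c)) :
    ENNReal.ofReal a ≤ 2 * (ENNReal.ofReal b + ENNReal.ofReal c) := by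
  rw [← ENNReal.ofReal_add hb hc, ← ENNReal.ofReal_ofNat 2, ← ENNReal.ofReal_mul (by norm_num)]
  exact ENNReal.ofReal_le_ofReal h

/-! ### Triangle inequalities for the squared norms -/

section Seminorm

variable {n : ℕ} {μ : Measure (EuclideanSpace ℝ (Fin n))} {τ : Set (EuclideanSpace ℝ (Fin n))}
  {v w : EuclideanSpace ℝ (Fin n) → ℝ}

theorem measurable_kernel_right (hv : Measurable v) (t : EuclideanSpace ℝ (Fin n)) :
    Measurable fun s => ENNReal.ofReal (|v t - v s| ^ 2 / dist t s ^ n) :=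
  ENNReal.measurable_ofReal.comp (((measurable_const.sub hv).abs.pow_const 2).div
    ((measurable_const.dist measurable_id).pow_const n))

theorem seminormSq_neg : seminormSq μ τ (-v) = seminormSq μ τ v := by
  unfold seminormSq
  simp only [Pi.neg_apply, neg_sub_neg, abs_sub_comm]

theorem seminormSq_add_le [SFinite μ] (hvm : Measurable v) :
    seminormSq μ τ (v + w) ≤ 2 * (seminormSq μ τ v + seminormSq μ τ w) := by
  unfold seminormSq
  rw [← lintegral_add_left (measurable_kernel hvm).lintegral_prod_right',
    ← lintegral_const_mul' _ _ (by simp)]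
  refine lintegral_mono fun t => ?_
  dsimp only
  rw [← lintegral_add_left (measurable_kernel_right hvm t), ← lintegral_const_mul' _ _ (by simp)]
  refine lintegral_mono fun s => ?_
  refine ofReal_le_two_mul_add (by positivity) (by positivity) ?_
  rw [← add_div, ← mul_div_assoc]
  refine div_le_div_of_nonneg_right ?_ (by positivity)
  simp only [Pi.add_apply, sq_abs]
  nlinarith [sq_nonneg ((v t - v s) - (w t - w s))]

theorem normSq_congr (h : v =ᵐ[μ] w) : normSq μ τ v = normSq μ τ w := by
  unfold normSq
  rw [seminormSq_congr h]
  congr 1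
  exact lintegral_congr_ae ((ae_restrict_of_ae h).mono fun s hs => by simp only [hs])

theorem normSq_add_le [SFinite μ] (hvm : Measurable v) :
    normSq μ τ (v + w) ≤ 2 * (normSq μ τ v + normSq μ τ w) := by
  have h : ∫⁻ s in τ, ENNReal.ofReal (|(v + w) s| ^ 2) ∂μ ≤
      2 * (∫⁻ s in τ, ENNReal.ofReal (|v s| ^ 2) ∂μ + ∫⁻ s in τ, ENNReal.ofReal (|w s| ^ 2) ∂μ) := by
    have hm : Measurable fun s => ENNReal.ofReal (|v s| ^ 2) :=
      ENNReal.measurable_ofReal.comp (hvm.abs.pow_const 2)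
    rw [← lintegral_add_left hm, ← lintegral_const_mul' _ _ (by simp)]
    refine lintegral_mono fun s => ofReal_le_two_mul_add (by positivity) (by positivity) ?_
    simp only [Pi.add_apply, sq_abs]
    nlinarith [sq_nonneg (v s - w s)]
  unfold normSq
  calc _ ≤ _ := add_le_add h (seminormSq_add_le hvm)
    _ = _ := by ring

end Seminorm

/-! ### The Poincaré inequality on patches -/

/-- Unit mean and orthogonality give w(t) = ∫ (w(t) - w(s)) φ(s) ds; then apply Cauchy–Schwarz on S.
-/
theorem sq_le_of_integral_mul_eq_zero {X : Type*} [MeasurableSpace X] {μ : Measure X}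
    [IsFiniteMeasure μ] {w φ : X → ℝ} (hw : MemLp w 2 μ) (hφ : MemLp φ 2 μ) {S : Set X}
    (hS : MeasurableSet S) (hφS : ∀ᵐ s ∂μ, s ∉ S → φ s = 0) (h1 : ∫ s, φ s ∂μ = 1)
    (h0 : ∫ s, w s * φ s ∂μ = 0) (t : X) :
    ENNReal.ofReal (|w t| ^ 2) ≤
      eLpNorm φ 2 (μ.restrict S) ^ 2 * ∫⁻ s in S, ENNReal.ofReal (|w t - w s| ^ 2) ∂μ := by
  have hφi : Integrable φ μ := hφ.integrable (by norm_num)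
  have hwφ : Integrable (fun s => w s * φ s) μ := hw.integrable_mul hφ
  have hwt : w t = ∫ s, (w t - w s) * φ s ∂μ := by
    simp_rw [sub_mul]
    rw [integral_sub (hφi.const_mul _) hwφ, integral_const_mul, h1, h0]
    ring
  have hle : ‖w t‖ₑ ≤ ∫⁻ s in S, ‖w t - w s‖ₑ * ‖φ s‖ₑ ∂μ := by
    calc ‖w t‖ₑ = ‖∫ s, (w t - w s) * φ s ∂μ‖ₑ := by rw [← hwt]
      _ ≤ ∫⁻ s, ‖(w t - w s) * φ s‖ₑ ∂μ := enorm_integral_le_lintegral_enorm _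
      _ = ∫⁻ s, S.indicator (fun s => ‖w t - w s‖ₑ * ‖φ s‖ₑ) s ∂μ := by
          refine lintegral_congr_ae (hφS.mono fun s hs => ?_)
          by_cases h : s ∈ S
          · simp [h, enorm_mul]
          · simp [h, hs h]
      _ = _ := lintegral_indicator hS _
  have hH := ENNReal.lintegral_mul_le_Lp_mul_Lq (μ.restrict S) Real.HolderConjugate.two_two
    (f := fun s => ‖w t - w s‖ₑ) (g := fun s => ‖φ s‖ₑ)
    ((aestronglyMeasurable_const.sub hw.1).enorm.restrict) (hφ.1.enorm.restrict)
  have hsq : ∀ a : ℝ≥0∞, (a ^ ((1 : ℝ) / 2)) ^ 2 = a := fun a => by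
    rw [← ENNReal.rpow_natCast, ← ENNReal.rpow_mul]; norm_num
  have heq : ∀ x : ℝ, ENNReal.ofReal (|x| ^ 2) = ‖x‖ₑ ^ 2 := fun x => by
    rw [ENNReal.ofReal_pow (abs_nonneg x), Real.enorm_eq_ofReal_abs]
  simp_rw [heq]
  calc ‖w t‖ₑ ^ 2 ≤ (∫⁻ s in S, ‖w t - w s‖ₑ * ‖φ s‖ₑ ∂μ) ^ 2 := by gcongr
    _ ≤ ((∫⁻ s in S, ‖w t - w s‖ₑ ^ (2 : ℝ) ∂μ) ^ ((1 : ℝ) / 2) *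
          (∫⁻ s in S, ‖φ s‖ₑ ^ (2 : ℝ) ∂μ) ^ ((1 : ℝ) / 2)) ^ 2 := by gcongr; exact hH
    _ = _ := by
        rw [mul_pow, mul_comm, hsq, eLpNorm_eq_lintegral_rpow_enorm_toReal (by simp) (by simp)]
        simp only [ENNReal.toReal_ofNat, ENNReal.rpow_ofNat, hsq]

/-- Integrate the pointwise bound over the patch. Since |t - s| ≤ 2h there, inserting |t - s|⁻ⁿ
costs (2h)ⁿ, and ‖φ_y‖² is at most K² h^(1-n), so a single power of h survives. -/
theorem lintegral_patch_sq_le {n : ℕ} {Ω : Domain n} {𝒯 : Mesh Ω.Γ} (hh : 0 < 𝒯.size) {K : ℝ}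
    {φ : 𝒯.nodes → Lp ℝ 2 Ω.surf} (hφ : IsAdmissibleFamily 𝒯 K φ) (w : Lp ℝ 2 Ω.surf)
    (y : 𝒯.nodes) (h0 : ∫ s, w s * φ y s ∂Ω.surf = 0) :
    ∫⁻ t in 𝒯.patch y, ENNReal.ofReal (|w t| ^ 2) ∂Ω.surf ≤
      ENNReal.ofReal (K ^ 2 * 2 ^ n * 𝒯.size) * seminormSq Ω.surf (𝒯.patch y) w := by
  have hS : MeasurableSet (𝒯.patch y) := (𝒯.isCompact_patch y).measurableSet
  rw [seminormSq, ← lintegral_const_mul' _ _ ENNReal.ofReal_ne_top]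
  refine setLIntegral_mono' hS fun t ht => ?_
  refine (sq_le_of_integral_mul_eq_zero (Lp.memLp w) (Lp.memLp (φ y)) hS (hφ.support_subset y)
    (hφ.integral_eq_one y) h0 t).trans ?_
  have hr : (𝒯.size ^ ((1 : ℝ) / 2 - n / 2)) ^ 2 * 𝒯.size ^ n = 𝒯.size := by
    rw [← Real.rpow_natCast, ← Real.rpow_natCast, ← Real.rpow_mul hh.le, ← Real.rpow_add hh]
    convert Real.rpow_one _ using 2
    push_cast
    ring
  have hK : eLpNorm (φ y) 2 (Ω.surf.restrict (𝒯.patch y)) ^ 2 ≤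
      ENNReal.ofReal ((K * 𝒯.size ^ ((1 : ℝ) / 2 - n / 2)) ^ 2) := by
    -- The sign of K is not prescribed, hence the absolute value.
    rw [← sq_abs, ENNReal.ofReal_pow (abs_nonneg _)]
    gcongr
    exact (hφ.norm_le y).trans (ENNReal.ofReal_le_ofReal (le_abs_self _))
  have hker : ∫⁻ s in 𝒯.patch y, ENNReal.ofReal (|w t - w s| ^ 2) ∂Ω.surf ≤
      ENNReal.ofReal ((2 * 𝒯.size) ^ n) *
        ∫⁻ s in 𝒯.patch y, ENNReal.ofReal (|w t - w s| ^ 2 / dist t s ^ n) ∂Ω.surf := by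
    rw [← lintegral_const_mul' _ _ ENNReal.ofReal_ne_top]
    refine setLIntegral_mono' hS fun s hs => ?_
    rw [← ENNReal.ofReal_mul (by positivity)]
    refine ENNReal.ofReal_le_ofReal ?_
    -- On the diagonal the kernel is 0 / 0 = 0, but the difference vanishes too.
    rcases eq_or_ne t s with rfl | hne
    · simp
    have hd := dist_pos.2 hne
    rw [← mul_div_assoc, le_div_iff₀ (by positivity), mul_comm]
    have := 𝒯.dist_le_of_mem_patch hs ht
    gcongr
  calc _ ≤ _ := mul_le_mul' hK hker
    _ = _ := by
      rw [← mul_assoc, ← ENNReal.ofReal_mul (by positivity)]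
      congr 2
      calc _ = K ^ 2 * 2 ^ n * ((𝒯.size ^ ((1 : ℝ) / 2 - n / 2)) ^ 2 * 𝒯.size ^ n) := by ring
        _ = _ := by rw [hr]

/-! ### Overlaps of elements are null sets -/

/-- A proper face is at most a point for n = 2, and lies in a line for n = 3. -/
theorem dimH_simplexFace_lt {n : ℕ} (hn : n = 2 ∨ n = 3) {I : Finset (Fin n)}
    (hI : I ≠ Finset.univ) : dimH (simplexFace I) < ((n - 1 : ℕ) : ℝ≥0) := by
  obtain ⟨k, hk⟩ : ∃ k, k ∉ I := by
    by_contra! h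
    exact hI (Finset.eq_univ_of_forall h)
  rcases hn with rfl | rfl
  · have : (simplexFace I).Subsingleton := by
      rintro a ⟨ha, haI⟩ b ⟨hb, hbI⟩
      have h1 := ha.2
      have h2 := hb.2
      have h3 := haI k hk
      have h4 := hbI k hk
      rw [Fin.sum_univ_two] at h1 h2
      ext m
      fin_cases k <;> fin_cases m <;> simp_all
    rw [this.dimH_zero]
    norm_num
  -- The indices k + 1 and k + 2, taken modulo 3, are the two vertices other than k.
  · let f : ℝ → Fin 3 → ℝ := fun t => t • Pi.single (k + 1) 1 + (1 - t) • Pi.single (k + 2) 1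
    have hf : ContDiff ℝ 1 f := by fun_prop
    have hsub : simplexFace I ⊆ range f := by
      rintro a ⟨ha, haI⟩
      have h1 := ha.2
      have h3 := haI k hk
      rw [Fin.sum_univ_three] at h1
      refine ⟨a (k + 1), ?_⟩
      ext m
      fin_cases k <;> fin_cases m <;> simp_all [f] <;> linarith
    refine ((dimH_mono hsub).trans hf.dimH_range_le).trans_lt ?_
    norm_num

namespace Mesh

/-- Two elements meet in the Lipschitz image of a proper face, which has dimension below n - 1. -/
theorem aedisjoint_elem {n : ℕ} {Ω : Domain n} {𝒯 : Mesh Ω.Γ} {σ : ℝ} (hσ : 𝒯.IsShapeRegular σ) :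
    Pairwise (Function.onFun (AEDisjoint Ω.surf) 𝒯.elem) := by
  intro i j hij
  obtain ⟨I, -, hI, -, h1, -, -⟩ := 𝒯.conforming i j hij
  have hL : LipschitzOnWith (σ * diam (𝒯.elem i)).toNNReal (𝒯.chart i) (simplexFace I) :=
    LipschitzOnWith.of_dist_le_mul fun a ha b hb =>
      (hσ i a ha.1 b hb.1).2.trans (by gcongr; exact Real.le_coe_toNNReal _)
  have h0 : μH[((n - 1 : ℕ) : ℝ≥0)] (𝒯.chart i '' simplexFace I) = 0 :=
    hausdorffMeasure_of_dimH_lt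
      (hL.dimH_image_le.trans_lt (dimH_simplexFace_lt Ω.two_or_three hI))
  have h2 : μHE[n - 1] (𝒯.chart i '' simplexFace I) = 0 := by
    rw [Measure.euclideanHausdorffMeasure_def, Measure.smul_apply]
    rw [NNReal.coe_natCast] at h0
    rw [h0, smul_zero]
  refine nonpos_iff_eq_zero.1 ((Measure.restrict_apply_le _ _).trans ?_)
  exact (congrArg _ h1).trans_le h2.le

/-- Counting pairs of an element and one of its vertices, each element occurs n times, and the
elements tile Γ up to null sets. -/
theorem sum_lintegral_patch_le {n : ℕ} {Ω : Domain n} {𝒯 : Mesh Ω.Γ} {σ : ℝ}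
    (hσ : 𝒯.IsShapeRegular σ) (g : EuclideanSpace ℝ (Fin n) → ℝ≥0∞) :
    ∑ y ∈ 𝒯.nodes, ∫⁻ t in 𝒯.patch y, g t ∂Ω.surf ≤ n * ∫⁻ t in Ω.Γ, g t ∂Ω.surf := by
  classical
  have hΓ : ∫⁻ t in Ω.Γ, g t ∂Ω.surf = ∑ i, ∫⁻ t in 𝒯.elem i, g t ∂Ω.surf := by
    rw [← tsum_fintype (L := .unconditional _), ← lintegral_iUnion₀
      (fun i => (𝒯.isCompact_elem i).measurableSet.nullMeasurableSet) (aedisjoint_elem hσ)]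
    exact congrArg (fun S => ∫⁻ t in S, g t ∂Ω.surf) 𝒯.iUnion_eq.symm
  calc ∑ y ∈ 𝒯.nodes, ∫⁻ t in 𝒯.patch y, g t ∂Ω.surf
      ≤ ∑ y ∈ 𝒯.nodes, ∑ p : Fin 𝒯.card × Fin n,
          if 𝒯.vertex p.1 p.2 = y then ∫⁻ t in 𝒯.elem p.1, g t ∂Ω.surf else 0 := by
        refine Finset.sum_le_sum fun y _ => ?_
        rw [← Finset.sum_filter]
        refine setLIntegral_le_sum _ (s := fun p : Fin 𝒯.card × Fin n => 𝒯.elem p.1)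
          (fun t ht => ?_) g
        obtain ⟨i, ⟨k, hk⟩, hti⟩ := mem_iUnion₂.1 ht
        exact ⟨(i, k), by simp [hk], hti⟩
    _ = ∑ p : Fin 𝒯.card × Fin n, ∫⁻ t in 𝒯.elem p.1, g t ∂Ω.surf := by
        rw [Finset.sum_comm]
        refine Finset.sum_congr rfl fun p _ => ?_
        rw [Finset.sum_ite_eq, if_pos (𝒯.vertex_mem_nodes p.1 p.2)]
    _ = n * ∫⁻ t in Ω.Γ, g t ∂Ω.surf := by
        rw [Fintype.sum_prod_type, hΓ, Finset.mul_sum]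
        simp

theorem sum_seminormSq_patch_le {n : ℕ} {Ω : Domain n} {𝒯 : Mesh Ω.Γ} {σ : ℝ}
    (hσ : 𝒯.IsShapeRegular σ) (w : EuclideanSpace ℝ (Fin n) → ℝ) :
    ∑ y ∈ 𝒯.nodes, seminormSq Ω.surf (𝒯.patch y) w ≤ n * seminormSq Ω.surf Ω.Γ w :=
  (Finset.sum_le_sum fun y _ => lintegral_mono fun _ => lintegral_mono_set (𝒯.patch_subset y)).trans
    (sum_lintegral_patch_le hσ _)

end Mesh

/-! ### Localization of the seminorm -/

theorem Domain.surf_restrict_Γ {n : ℕ} (Ω : Domain n) : Ω.surf.restrict Ω.Γ = Ω.surf := by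
  rw [Domain.surf, Measure.restrict_restrict Ω.isCompact_Γ.measurableSet, inter_self]

theorem Domain.ae_mem_Γ {n : ℕ} (Ω : Domain n) : ∀ᵐ t ∂Ω.surf, t ∈ Ω.Γ :=
  ae_restrict_mem Ω.isCompact_Γ.measurableSet

/-- Integration of a kernel that is controlled on the squares of the sets `ω y`, and elsewhere by a
symmetric kernel `q` with bounded integrals. -/
theorem lintegral_lintegral_le_sum_add {X ι : Type*} [MeasurableSpace X] {μ : Measure X} [SFinite μ]
    {N : Finset ι} {ω : ι → Set X} (hω : ∀ y, MeasurableSet (ω y)) {k q : X → X → ℝ≥0∞}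
    {f : X → ℝ≥0∞} {J : ℝ≥0∞} (hk : Measurable (Function.uncurry k))
    (hq : Measurable (Function.uncurry q)) (hf : Measurable f) (hqsymm : ∀ t s, q t s = q s t)
    (hJ : ∀ᵐ t ∂μ, ∫⁻ s, q t s ∂μ ≤ J)
    (hpt : ∀ᵐ t ∂μ, ∀ᵐ s ∂μ, k t s ≤
      (∑ y ∈ N, (ω y).indicator (fun _ => (ω y).indicator (k t) s) t) +
        (2 * f t * q t s + 2 * (f s * q t s))) :
    ∫⁻ t, ∫⁻ s, k t s ∂μ ∂μ ≤
      (∑ y ∈ N, ∫⁻ t in ω y, ∫⁻ s in ω y, k t s ∂μ ∂μ) + 4 * J * ∫⁻ t, f t ∂μ := by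
  have hk1 : ∀ t, Measurable (k t) := fun t => hk.comp measurable_prodMk_left
  have hq1 : ∀ t, Measurable (q t) := fun t => hq.comp measurable_prodMk_left
  have hind : ∀ t y, Measurable fun s => (ω y).indicator (fun _ => (ω y).indicator (k t) s) t :=
    fun t y => by
      by_cases h : t ∈ ω y
      · simpa only [indicator_of_mem h] using (hk1 t).indicator (hω y)
      · simp only [indicator_of_notMem h, measurable_const]
  have hinner : ∀ᵐ t ∂μ, ∫⁻ s, k t s ∂μ ≤
      (∑ y ∈ N, (ω y).indicator (fun t => ∫⁻ s in ω y, k t s ∂μ) t) +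
        (2 * f t * J + 2 * ∫⁻ s, f s * q t s ∂μ) := by
    filter_upwards [hJ, hpt] with t htJ ht
    refine (lintegral_mono_ae ht).trans ?_
    rw [lintegral_add_left (Finset.measurable_sum _ fun y _ => hind t y),
      lintegral_finsetSum _ fun y _ => hind t y, lintegral_add_left ((hq1 t).const_mul _),
      lintegral_const_mul _ (hq1 t), lintegral_const_mul' 2 _ (by simp)]
    refine add_le_add (Finset.sum_le_sum fun y _ => ?_)
      (add_le_add (mul_le_mul_right htJ _) le_rfl)
    by_cases h : t ∈ ω y
    · simp only [indicator_of_mem h]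
      rw [lintegral_indicator (hω y)]
    · simp only [indicator_of_notMem h, lintegral_zero, le_refl]
  have hfq : Measurable (Function.uncurry fun t s => f s * q t s) :=
    (hf.comp measurable_snd).mul hq
  -- Tonelli and the symmetry of q move the bound J to the other variable.
  have hswap : ∫⁻ t, ∫⁻ s, f s * q t s ∂μ ∂μ ≤ J * ∫⁻ t, f t ∂μ := by
    rw [lintegral_lintegral_swap hfq.aemeasurable, ← lintegral_const_mul _ hf]
    refine lintegral_mono_ae (hJ.mono fun s hs => ?_)
    simp_rw [hqsymm _ s]
    rw [lintegral_const_mul _ (hq1 s), mul_comm]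
    exact mul_le_mul_left hs _
  have hpm : ∀ y, Measurable ((ω y).indicator fun t => ∫⁻ s in ω y, k t s ∂μ) := fun y =>
    (hk.lintegral_prod_right' (ν := μ.restrict (ω y))).indicator (hω y)
  refine (lintegral_mono_ae hinner).trans ?_
  rw [lintegral_add_left (Finset.measurable_sum _ fun y _ => hpm y),
    lintegral_finsetSum _ fun y _ => hpm y, lintegral_add_left ((hf.const_mul _).mul_const _),
    lintegral_const_mul' 2 (fun t => ∫⁻ s, f s * q t s ∂μ) (by simp), lintegral_mul_const _ (hf.const_mul _),
    lintegral_const_mul _ hf]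
  refine add_le_add (Finset.sum_le_sum fun y _ => (lintegral_indicator (hω y) _).le) ?_
  calc 2 * (∫⁻ t, f t ∂μ) * J + 2 * ∫⁻ t, ∫⁻ s, f s * q t s ∂μ ∂μ
      ≤ 2 * (∫⁻ t, f t ∂μ) * J + 2 * (J * ∫⁻ t, f t ∂μ) := by gcongr
    _ = 4 * J * ∫⁻ t, f t ∂μ := by ring

/-- The kernel `|t - s|⁻ⁿ` truncated to pairs of points of distance at least `r`. -/
def farKernel {X : Type*} [PseudoMetricSpace X] (n : ℕ) (r : ℝ) (t s : X) : ℝ≥0∞ :=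
  {s | r ≤ dist t s}.indicator (fun s => ENNReal.ofReal ((dist t s ^ n)⁻¹)) s

theorem farKernel_comm {X : Type*} [PseudoMetricSpace X] (n : ℕ) (r : ℝ) (t s : X) :
    farKernel n r t s = farKernel n r s t := by
  simp only [farKernel, indicator, mem_ofPred_eq, dist_comm t s]

theorem measurable_farKernel {X : Type*} [PseudoMetricSpace X] [SecondCountableTopology X]
    [MeasurableSpace X] [OpensMeasurableSpace X] (n : ℕ) (r : ℝ) :
    Measurable (Function.uncurry (farKernel (X := X) n r)) := by
  have h1 : MeasurableSet {p : X × X | r ≤ dist p.1 p.2} :=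
    measurableSet_le measurable_const (measurable_fst.dist measurable_snd)
  have h2 : Measurable fun p : X × X => ENNReal.ofReal ((dist p.1 p.2 ^ n)⁻¹) :=
    ENNReal.measurable_ofReal.comp ((measurable_fst.dist measurable_snd).pow_const n).inv
  exact h2.indicator h1

theorem kernel_le_farKernel {X : Type*} [PseudoMetricSpace X] {n : ℕ} {r : ℝ} {t s : X}
    (h : r ≤ dist t s) (w : X → ℝ) :
    ENNReal.ofReal (|w t - w s| ^ 2 / dist t s ^ n) ≤
      2 * ENNReal.ofReal (|w t| ^ 2) * farKernel n r t s +
        2 * (ENNReal.ofReal (|w s| ^ 2) * farKernel n r t s) := by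
  have hqe : farKernel n r t s = ENNReal.ofReal ((dist t s ^ n)⁻¹) :=
    indicator_of_mem (s := {s | r ≤ dist t s}) h _
  rw [hqe, mul_assoc, ← mul_add, ← ENNReal.ofReal_mul (by positivity),
    ← ENNReal.ofReal_mul (by positivity), div_eq_mul_inv]
  refine ofReal_le_two_mul_add (by positivity) (by positivity) ?_
  rw [← add_mul, ← mul_assoc]
  refine mul_le_mul_of_nonneg_right ?_ (by positivity)
  simp only [sq_abs]
  nlinarith [sq_nonneg (w t + w s)]

/-- The seminorm splits into contributions of patches and an `L²`-term controlling the pairs of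
points that lie in no common patch. -/
theorem seminormSq_le_sum_add {n : ℕ} {Ω : Domain n} {𝒯 : Mesh Ω.Γ} {A r : ℝ} (hA : 0 ≤ A)
    (hball : ∀ t ∈ Ω.Γ, ∀ r, 0 < r → Ω.surf (ball t r) ≤ ENNReal.ofReal (A * r ^ (n - 1)))
    (hr : 0 < r) (hnear : ∀ s ∈ Ω.Γ, ∀ t ∈ Ω.Γ, dist t s < r →
      ∃ y ∈ 𝒯.nodes, s ∈ 𝒯.patch y ∧ t ∈ 𝒯.patch y)
    {w : EuclideanSpace ℝ (Fin n) → ℝ} (hw : Measurable w) :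
    seminormSq Ω.surf Ω.Γ w ≤ (∑ y ∈ 𝒯.nodes, seminormSq Ω.surf (𝒯.patch y) w) +
      4 * ENNReal.ofReal (A * 2 ^ n / r) *
        ∫⁻ t in Ω.Γ, ENNReal.ofReal (|w t| ^ 2) ∂Ω.surf := by
  have hn : n - 1 + 1 = n := by rcases Ω.two_or_three with h | h <;> omega
  have hf : Measurable fun t => ENNReal.ofReal (|w t| ^ 2) :=
    ENNReal.measurable_ofReal.comp (hw.abs.pow_const 2)
  have hJ : ∀ t ∈ Ω.Γ, ∫⁻ s, farKernel n r t s ∂Ω.surf ≤ ENNReal.ofReal (A * 2 ^ n / r) := by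
    intro t ht
    have := lintegral_inv_dist_pow_le hA (hball t ht) hr
    rw [hn] at this
    simp only [farKernel]
    have hm : MeasurableSet {s | r ≤ dist t s} :=
      measurableSet_le measurable_const (measurable_const.dist measurable_id)
    rwa [lintegral_indicator hm]
  simp only [seminormSq, Ω.surf_restrict_Γ]
  refine lintegral_lintegral_le_sum_add
    (k := fun t s => ENNReal.ofReal (|w t - w s| ^ 2 / dist t s ^ n))
    (fun y => (𝒯.isCompact_patch y).measurableSet)
    (measurable_kernel hw) (measurable_farKernel n r) hf (farKernel_comm n r)
    (Ω.ae_mem_Γ.mono hJ) (Ω.ae_mem_Γ.mono fun t ht => Ω.ae_mem_Γ.mono fun s hs => ?_)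
  -- A near pair is counted in a shared patch; a far pair is absorbed by the truncated kernel.
  rcases lt_or_ge (dist t s) r with hlt | hge
  · obtain ⟨y, hy, hsy, hty⟩ := hnear s hs t ht hlt
    refine le_add_right (le_trans ?_ (Finset.single_le_sum (fun _ _ => zero_le) hy))
    rw [indicator_of_mem hty, indicator_of_mem hsy]
  · exact le_add_left (kernel_le_farKernel hge w)

/-- A function orthogonal to an admissible family is controlled by its seminorms on patches. -/
theorem exists_normSq_le_sum_seminormSq {n : ℕ} (Ω : Domain n) (σ κ K : ℝ) :
    ∃ C : ℝ≥0, ∀ 𝒯 : Mesh Ω.Γ, 𝒯.IsShapeRegular σ → 𝒯.IsQuasiUniform κ →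
      ∀ φ : 𝒯.nodes → Lp ℝ 2 Ω.surf, IsAdmissibleFamily 𝒯 K φ →
      ∀ w : Lp ℝ 2 Ω.surf, (∀ y, ∫ s, w s * φ y s ∂Ω.surf = 0) →
        normSq Ω.surf Ω.Γ w ≤ C * ∑ y ∈ 𝒯.nodes, seminormSq Ω.surf (𝒯.patch y) w := by
  -- Mesh constants may be enlarged, so they are replaced by values at least 1.
  obtain ⟨δ, hδ, hpatch⟩ := exists_common_patch Ω (le_max_right σ 1) (le_max_right κ 1)
  obtain ⟨A, hA, hball⟩ := Ω.exists_measure_ball_le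
  have hn2 : 2 ≤ n := by have := Ω.two_or_three; omega
  -- The summands come from the L²-norm (with h ≤ diam Γ), the near pairs, and the far pairs, where
  -- the tail 1/(δh) meets the Poincaré factor h.
  refine ⟨(K ^ 2 * 2 ^ n * diam Ω.Γ + (1 + 4 * A * 2 ^ n / δ * (K ^ 2 * 2 ^ n))).toNNReal,
    fun 𝒯 hσ hκ φ hφ w hw => ?_⟩
  -- Positivity of h requires an element; without any, Γ is empty.
  rcases isEmpty_or_nonempty (Fin 𝒯.card) with hempty | ⟨⟨i⟩⟩
  · have hΓ : Ω.Γ = ∅ := by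
      refine eq_empty_of_forall_notMem fun x hx => ?_
      obtain ⟨i, -⟩ := 𝒯.exists_mem_elem hx
      exact hempty.elim i
    have h0 : normSq Ω.surf Ω.Γ w = 0 := by
      simp only [normSq, seminormSq, hΓ, Measure.restrict_empty, lintegral_zero_measure, add_zero]
    rw [h0]
    exact zero_le
  have hh := 𝒯.size_pos hn2 i
  set S := ∑ y ∈ 𝒯.nodes, seminormSq Ω.surf (𝒯.patch y) w
  have hL2 : ∫⁻ t in Ω.Γ, ENNReal.ofReal (|w t| ^ 2) ∂Ω.surf ≤
      ENNReal.ofReal (K ^ 2 * 2 ^ n * 𝒯.size) * S := by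
    refine (setLIntegral_le_sum 𝒯.nodes (s := 𝒯.patch) (fun t ht => ?_) _).trans ?_
    · obtain ⟨j, hj⟩ := 𝒯.exists_mem_elem ht
      exact ⟨_, 𝒯.vertex_mem_nodes j ⟨0, by omega⟩, 𝒯.elem_subset_patch j _ hj⟩
    · rw [Finset.mul_sum]
      exact Finset.sum_le_sum fun y hy => lintegral_patch_sq_le hh hφ w ⟨y, hy⟩ (hw ⟨y, hy⟩)
  have hsemi := seminormSq_le_sum_add hA hball (mul_pos hδ hh)
    (hpatch 𝒯 (hσ.mono (le_max_left _ _)) (hκ.mono (le_max_left _ _)))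
    (Lp.stronglyMeasurable w).measurable
  have hD := 𝒯.size_le_diam Ω.isCompact_Γ.isBounded
  have hD0 := hh.trans_le hD
  calc normSq Ω.surf Ω.Γ w
      ≤ ENNReal.ofReal (K ^ 2 * 2 ^ n * 𝒯.size) * S + (S +
          4 * ENNReal.ofReal (A * 2 ^ n / (δ * 𝒯.size)) *
            (ENNReal.ofReal (K ^ 2 * 2 ^ n * 𝒯.size) * S)) :=
        add_le_add hL2 (hsemi.trans (by gcongr))
    _ = ENNReal.ofReal (K ^ 2 * 2 ^ n * 𝒯.size +
          (1 + 4 * A * 2 ^ n / δ * (K ^ 2 * 2 ^ n))) * S := by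
        rw [← ENNReal.ofReal_ofNat 4, ← ENNReal.ofReal_mul (by norm_num), ← mul_assoc,
          ← ENNReal.ofReal_mul (by positivity), ENNReal.ofReal_add (by positivity) (by positivity),
          ENNReal.ofReal_add (by positivity) (by positivity), ENNReal.ofReal_one, add_mul, add_mul,
          one_mul]
        congr 4
        field_simp
    _ ≤ ENNReal.ofReal (K ^ 2 * 2 ^ n * diam Ω.Γ +
          (1 + 4 * A * 2 ^ n / δ * (K ^ 2 * 2 ^ n))) * S := by
        gcongr

end TraceNorm

end

/-! ### The norm equivalence -/

theorem mainTheorem2 {n : ℕ} (Ω : TraceNorm.Domain n) (σ κ K : ℝ) (M : NNReal) :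
    ∃ C : NNReal, 0 < C ∧
      ∀ (𝒯 : TraceNorm.Mesh Ω.Γ), 𝒯.IsShapeRegular σ → 𝒯.IsQuasiUniform κ →
      ∀ (P : TraceNorm.HHalf Ω →ₗ[ℝ] TraceNorm.HHalf Ω),
        P ∘ₗ P = P →
        (∀ v, TraceNorm.normSq Ω.surf Ω.Γ (P v).1 ≤
          (M : ENNReal) ^ 2 * TraceNorm.normSq Ω.surf Ω.Γ v.1) →
      ∀ (φ : 𝒯.nodes → MeasureTheory.Lp ℝ 2 Ω.surf),
        TraceNorm.IsAdmissibleFamily 𝒯 K φ →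
        (∀ v y, ∫ s, (v - P v).1 s * φ y s ∂Ω.surf = 0) →
      ∀ v : TraceNorm.HHalf Ω,
        TraceNorm.normSq Ω.surf Ω.Γ v.1 ≤
          C * (TraceNorm.normSq Ω.surf Ω.Γ (P v).1 +
            ∑ y ∈ 𝒯.nodes, TraceNorm.seminormSq Ω.surf (𝒯.patch y) (v - P v).1) ∧
        TraceNorm.normSq Ω.surf Ω.Γ (P v).1 +
            ∑ y ∈ 𝒯.nodes, TraceNorm.seminormSq Ω.surf (𝒯.patch y) (v - P v).1 ≤
          C * TraceNorm.normSq Ω.surf Ω.Γ v.1 := by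
  obtain ⟨C₀, hC₀⟩ := TraceNorm.exists_normSq_le_sum_seminormSq Ω σ κ K
  -- The sum of the constants of the two estimates: 2(1 + C₀) for the lower one, M² + 2n(1 + M²) for
  -- the upper one.
  refine ⟨2 * (1 + C₀) + (M ^ 2 + n * (2 * (1 + M ^ 2))), by positivity,
    fun 𝒯 hσ hκ P _ hM φ hφ horth v => ?_⟩
  have hPm : Measurable ((P v).1 : EuclideanSpace ℝ (Fin n) → ℝ) :=
    (Lp.stronglyMeasurable _).measurable
  have hvm : Measurable (v.1 : EuclideanSpace ℝ (Fin n) → ℝ) :=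
    (Lp.stronglyMeasurable _).measurable
  have hsub : ((v - P v).1 : EuclideanSpace ℝ (Fin n) → ℝ) =ᵐ[Ω.surf] v.1 + -(P v).1 := by
    rw [← sub_eq_add_neg]
    exact Lp.coeFn_sub v.1 (P v).1
  have hadd : (v.1 : EuclideanSpace ℝ (Fin n) → ℝ) =ᵐ[Ω.surf] (P v).1 + (v - P v).1 :=
    hsub.mono fun s hs => by
      rw [Pi.add_apply, hs, Pi.add_apply, Pi.neg_apply]
      ring
  constructor
  · rw [TraceNorm.normSq_congr hadd]
    refine (TraceNorm.normSq_add_le hPm).trans ?_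
    have h := hC₀ 𝒯 hσ hκ φ hφ _ (horth v)
    set S := ∑ y ∈ 𝒯.nodes, TraceNorm.seminormSq Ω.surf (𝒯.patch y) (v - P v).1
    set N := TraceNorm.normSq Ω.surf Ω.Γ (P v).1
    calc _ ≤ 2 * (N + C₀ * S) := by gcongr
      _ ≤ 2 * ((1 + C₀) * N + (1 + C₀) * S) := by
          gcongr
          · exact le_mul_of_one_le_left zero_le le_self_add
          · exact le_add_self
      _ = 2 * (1 + C₀) * (N + S) := by ring
      _ ≤ _ := by
          gcongr
          push_cast
          exact le_self_add
  · have h1 := TraceNorm.Mesh.sum_seminormSq_patch_le hσ ((v - P v).1)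
    have h2 : TraceNorm.seminormSq Ω.surf Ω.Γ (v - P v).1 ≤
        2 * (TraceNorm.normSq Ω.surf Ω.Γ v.1 + TraceNorm.normSq Ω.surf Ω.Γ (P v).1) := by
      rw [TraceNorm.seminormSq_congr hsub]
      refine (TraceNorm.seminormSq_add_le hvm).trans ?_
      rw [TraceNorm.seminormSq_neg]
      gcongr <;> exact le_add_self
    set N := TraceNorm.normSq Ω.surf Ω.Γ v.1
    calc _ ≤ (M : ℝ≥0∞) ^ 2 * N + n * (2 * (N + M ^ 2 * N)) := by
          refine add_le_add (hM v) (h1.trans ?_)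
          gcongr
          refine h2.trans ?_
          gcongr
          exact hM v
      _ = (M ^ 2 + n * (2 * (1 + M ^ 2))) * N := by ring
      _ ≤ _ := by
          gcongr
          push_cast
          exact le_add_self
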